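/- **Setting.** Let $\langle x,y\rangle=x^1y^1+x^2y^2+x^3y^3-x^0y^4-x^4y^0$ on $\mathbb R^5$ (coordinates $x^0,\dots,x^4$), let $\mathbb Q_3=\{[x]\in\mathbb P(\mathbb R^5):\langle x,x\rangle=0\}$ be the conformal 3-sphere, and let $\chi:\mathbb R^3\to\mathbb Q_3$, $\chi(x)=[1:x:\tfrac12|x|^2]$, whose image is $\mathbb Q_3$ minus one point. The Möbius group $\mathrm{M\ddot ob}(3)$ of orientation-preserving conformal transformations is the group of linear isometries of $\langle\cdot,\cdot\rangle$ with determinant $1$ which preserve the positive light cone $\{\langle v,v\rangle=0,\ v^0+v^4>0\}$; it acts on $\mathbb Q_3$ projectively. Let $f:\mathbb R\to\mathbb Q_3$ be a closed curve, i.e. a smooth immersion with some period $L>0$. A frame along $f$ on an open set $U\subset\mathbb R$ is a smooth map $e=(e_0|\cdots|e_4):U\to\mathrm{M\ddot ob}(3)$ with $[e_0]=f$; put $\phi=e^{-1}de=(\phi^a_b)$. It is a Darboux frame if $\phi^2_0=\phi^3_0=0$, $\phi^1_0>0$ (on $d/dt$) and $\phi^2_1=\phi^3_1=0$. Then write $\phi^0_\alpha=p^\alpha\phi^1_0$,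 $\alpha=2,3$. The curve $f$ is *1-generic* if around every point there is a Darboux frame with $(p^2)^2+(p^3)^2\ne0$ at that point (this does not depend on the Darboux frame). A *Frenet frame* is a Darboux frame with $\phi^0_2=\phi^1_0$, $\phi^0_3=0$ and $\phi^0_0=0$; for it, $ds=\phi^1_0$ is the differential of the conformal arclength and the conformal curvature $\mu_2$ is defined by $\phi^3_2=\mu_2\,ds$. For a regular curve $F:\mathbb R\to\mathbb R^3$ with nowhere vanishing curvature let $s_e$ be the Euclidean arclength and $\tau$ the torsion, $\tau=\langle dN/ds_e,\,T\times N\rangle$ with $T$ the unit tangent and $N$ the principal normal. **Proposition.** Let $f$ be a closed 1-generic curve in $\mathbb Q_3$ with period $L$ which lies in $\chi(\mathbb R^3)$, $f=\chi\circ F$, and suppose that the Euclidean curvature of $F$ vanishes nowhere (so that the torsion of $F$ is defined). Then $f$ has exactly one Frenet frame defined on all of $\mathbb R$, and $$\frac1{2\pi}\int_0^L\mu_2\,ds\equiv\frac1{2\pi}\int_0^L\tau\,ds_e\pmod{\mathbb Z}.$$ Consequently the total twist $\mathrm{Tw}(f)=\frac1{2\pi}\int_0^L\tau\,ds_e\ (\mathrm{mod}\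 \mathbb Z)$ is a conformal invariant: if $G\in\mathrm{M\ddot ob}(3)$ and $G\cdot f=\chi\circ F'$ for a curve $F':\mathbb R\to\mathbb R^3$ whose curvature also vanishes nowhere, then the total twists of $F$ and $F'$ coincide in $\mathbb R/\mathbb Z$. -/

import Mathlib

open scoped ContDiff Matrix LinearAlgebra.Projectivization

noncomputable section

/-! ### The conformal sphere `Q_3` and the Möbius group `Möb(3)` -/

/-- The homogeneous coordinate space `ℝ⁵`, with coordinates `x⁰, x¹, x², x³, x⁴`. -/
abbrev HomCoord : Type := Fin 5 → ℝ

/-- The matrix of the Lorentzian product `⟨x, y⟩ = x¹y¹ + x²y² + x³y³ - x⁰y⁴ - x⁴y⁰`. -/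
def lorentzMatrix : Matrix (Fin 5) (Fin 5) ℝ :=
  !![0, 0, 0, 0, -1;
     0, 1, 0, 0, 0;
     0, 0, 1, 0, 0;
     0, 0, 0, 1, 0;
     -1, 0, 0, 0, 0]

/-- The quadratic form `(x¹)² + (x²)² + (x³)² - 2x⁰x⁴`. -/
def lorentzForm (v : HomCoord) : ℝ := v ⬝ᵥ (lorentzMatrix *ᵥ v)

/-- The Darboux hyperquadric `Q_3` in real projective 4-space. -/
def darbouxQuadric : Set (ℙ ℝ HomCoord) := {p | lorentzForm p.rep = 0}

/-- The positive light cone. -/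
def positiveLightCone : Set HomCoord := {v | lorentzForm v = 0 ∧ 0 < v 0 + v 4}

/-- The Möbius group `Möb(3)`: Lorentz transformations preserving the positive light cone and the
orientation (the identity component of the Lorentz group). -/
def moebiusGroup : Set (Matrix (Fin 5) (Fin 5) ℝ) :=
  {G | Gᵀ * lorentzMatrix * G = lorentzMatrix ∧ G.det = 1 ∧
    ∀ v ∈ positiveLightCone, G *ᵥ v ∈ positiveLightCone}

lemma moebius_injective (G : moebiusGroup) :
    Function.Injective (Matrix.toLin' (G : Matrix (Fin 5) (Fin 5) ℝ)) := by
  have h : IsUnit (G : Matrix (Fin 5) (Fin 5) ℝ) := by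
    rw [Matrix.isUnit_iff_isUnit_det, G.2.2.1]
    exact isUnit_one
  intro x y hxy
  exact Matrix.mulVec_injective_of_isUnit h (by simpa using hxy)

/-- The projective action of `Möb(3)`, `[v] ↦ [G v]`. -/
def moebiusAct (G : moebiusGroup) (p : ℙ ℝ HomCoord) : ℙ ℝ HomCoord :=
  Projectivization.map (Matrix.toLin' (G : Matrix (Fin 5) (Fin 5) ℝ)) (moebius_injective G) p

/-- Homogeneous coordinates `(1, x, |x|²/2)` of the image of `x ∈ ℝ³`. -/
def chiVec (x : EuclideanSpace ℝ (Fin 3)) : HomCoord := ![1, x 0, x 1, x 2, ‖x‖ ^ 2 / 2]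

lemma chiVec_ne_zero (x : EuclideanSpace ℝ (Fin 3)) : chiVec x ≠ 0 := by
  intro h
  simpa [chiVec] using congrFun h 0

/-- The Dirac-Weyl embedding `χ : ℝ³ → Q_3`, whose image is `Q_3` minus the point `(0:0:0:0:1)`. -/
def chi (x : EuclideanSpace ℝ (Fin 3)) : ℙ ℝ HomCoord :=
  Projectivization.mk ℝ (chiVec x) (chiVec_ne_zero x)

/-! ### Curves in `Q_3` -/

/-- `f` is a smooth immersion into projective space: it has smooth local lifts `v` to homogeneous
coordinates, for which `v` and its derivative are linearly independent. -/
def IsImmersedCurve (f : ℝ → ℙ ℝ HomCoord) : Prop :=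
  ∀ q : ℝ, ∃ U : Set ℝ, IsOpen U ∧ q ∈ U ∧ ∃ v : ℝ → HomCoord, ContDiffOn ℝ ∞ v U ∧
    ∀ t ∈ U, (∃ h : v t ≠ 0, Projectivization.mk ℝ (v t) h = f t) ∧
      LinearIndependent ℝ ![v t, deriv v t]

/-- `f` is a closed (smooth, immersed) curve in `Q_3`, presented as a map with period `L > 0`. -/
structure IsClosedCurve (f : ℝ → ℙ ℝ HomCoord) (L : ℝ) : Prop where
  pos : 0 < L
  mem_quadric : ∀ t, f t ∈ darbouxQuadric
  immersed : IsImmersedCurve f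
  periodic : Function.Periodic f L

/-! ### Moving frames -/

/-- The pull-back `φ = e⁻¹ de` of the Maurer-Cartan form along `e`, evaluated on `d/dt`.
Its entry in row `a` and column `b` is `φ^a_b(d/dt)`. -/
def mcForm (e : ℝ → Matrix (Fin 5) (Fin 5) ℝ) (t : ℝ) : Matrix (Fin 5) (Fin 5) ℝ :=
  (e t)⁻¹ * Matrix.of fun i j => deriv (fun u => e u i j) t

/-- `e : U → Möb(3)` is a zeroth order frame along `f`: it is smooth and `[e_0] = f`. -/
structure IsFrame (f : ℝ → ℙ ℝ HomCoord) (U : Set ℝ)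
    (e : ℝ → Matrix (Fin 5) (Fin 5) ℝ) : Prop where
  smooth : ∀ i j, ContDiffOn ℝ ∞ (fun t => e t i j) U
  mem_moebius : ∀ t ∈ U, e t ∈ moebiusGroup
  proj : ∀ t ∈ U, ∃ h : (fun i => e t i 0) ≠ 0, Projectivization.mk ℝ (fun i => e t i 0) h = f t

/-- First order frames: `φ²_0 = φ³_0 = 0`, with `φ¹_0` positive in the direction of the curve. -/
structure IsFirstOrderFrame (f : ℝ → ℙ ℝ HomCoord) (U : Set ℝ)
    (e : ℝ → Matrix (Fin 5) (Fin 5) ℝ) : Prop extends IsFrame f U e where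
  phi20 : ∀ t ∈ U, mcForm e t 2 0 = 0
  phi30 : ∀ t ∈ U, mcForm e t 3 0 = 0
  phi10_pos : ∀ t ∈ U, 0 < mcForm e t 1 0

/-- Second order frames, or Darboux frames: moreover `φ²_1 = φ³_1 = 0`. -/
structure IsDarbouxFrame (f : ℝ → ℙ ℝ HomCoord) (U : Set ℝ)
    (e : ℝ → Matrix (Fin 5) (Fin 5) ℝ) : Prop extends IsFirstOrderFrame f U e where
  phi21 : ∀ t ∈ U, mcForm e t 2 1 = 0
  phi31 : ∀ t ∈ U, mcForm e t 3 1 = 0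

/-- The coefficient `p^α` of a Darboux frame, defined by `φ⁰_α = p^α φ¹_0`. -/
def darbouxCoeff (e : ℝ → Matrix (Fin 5) (Fin 5) ℝ) (α : Fin 5) (t : ℝ) : ℝ :=
  mcForm e t 0 α / mcForm e t 1 0

/-- The point `q` is 1-generic for `f`: `(p²)² + (p³)² ≠ 0` at `q` (whether this holds does not
depend on the Darboux frame around `q`). -/
def IsOneGenericAt (f : ℝ → ℙ ℝ HomCoord) (q : ℝ) : Prop :=
  ∃ U : Set ℝ, IsOpen U ∧ q ∈ U ∧ ∃ e, IsDarbouxFrame f U e ∧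
    darbouxCoeff e 2 q ^ 2 + darbouxCoeff e 3 q ^ 2 ≠ 0

/-- Every point is 1-generic. -/
def IsOneGeneric (f : ℝ → ℙ ℝ HomCoord) : Prop := ∀ q, IsOneGenericAt f q

/-- Third order frames: Darboux frames with `φ⁰_2 = φ¹_0` and `φ⁰_3 = 0`. -/
structure IsThirdOrderFrame (f : ℝ → ℙ ℝ HomCoord) (U : Set ℝ)
    (e : ℝ → Matrix (Fin 5) (Fin 5) ℝ) : Prop extends IsDarbouxFrame f U e where
  phi02 : ∀ t ∈ U, mcForm e t 0 2 = mcForm e t 1 0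
  phi03 : ∀ t ∈ U, mcForm e t 0 3 = 0

/-- Frenet frames: third order frames with `φ⁰_0 = 0`. -/
structure IsFrenetFrame (f : ℝ → ℙ ℝ HomCoord) (U : Set ℝ)
    (e : ℝ → Matrix (Fin 5) (Fin 5) ℝ) : Prop extends IsThirdOrderFrame f U e where
  phi00 : ∀ t ∈ U, mcForm e t 0 0 = 0

/-- The derivative `ds/dt` of the conformal arclength, `ds = φ¹_0`, for a Frenet frame `e`. -/
def conformalSpeed (e : ℝ → Matrix (Fin 5) (Fin 5) ℝ) (t : ℝ) : ℝ := mcForm e t 1 0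

/-- The conformal curvature `μ₂`, defined by `φ³_2 = μ₂ φ¹_0`, for a Frenet frame `e`. -/
def mu2 (e : ℝ → Matrix (Fin 5) (Fin 5) ℝ) (t : ℝ) : ℝ := mcForm e t 3 2 / mcForm e t 1 0

/-! ### Euclidean invariants of a curve in `ℝ³` -/

/-- The derivative of `X` with respect to the Euclidean arclength of `F`. -/
def arcDeriv (F X : ℝ → EuclideanSpace ℝ (Fin 3)) (t : ℝ) : EuclideanSpace ℝ (Fin 3) :=
  ‖deriv F t‖⁻¹ • deriv X t

/-- The unit tangent vector. -/
def unitTangent (F : ℝ → EuclideanSpace ℝ (Fin 3)) : ℝ → EuclideanSpace ℝ (Fin 3) :=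
  arcDeriv F F

/-- The Euclidean curvature. -/
def curvature (F : ℝ → EuclideanSpace ℝ (Fin 3)) (t : ℝ) : ℝ :=
  ‖arcDeriv F (unitTangent F) t‖

/-- The principal normal vector. -/
def principalNormal (F : ℝ → EuclideanSpace ℝ (Fin 3)) (t : ℝ) : EuclideanSpace ℝ (Fin 3) :=
  (curvature F t)⁻¹ • arcDeriv F (unitTangent F) t

/-- The binormal vector, the cross product of the tangent and the principal normal. -/
def binormal (F : ℝ → EuclideanSpace ℝ (Fin 3)) (t : ℝ) : EuclideanSpace ℝ (Fin 3) :=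
  WithLp.toLp 2 (crossProduct (unitTangent F t).ofLp (principalNormal F t).ofLp)

/-- The Euclidean torsion `τ`. -/
def torsion (F : ℝ → EuclideanSpace ℝ (Fin 3)) (t : ℝ) : ℝ :=
  inner ℝ (arcDeriv F (principalNormal F) t) (binormal F t)

/-- The total twist `(1/2π) ∫ τ ds_e (mod ℤ)` over one period. -/
def totalTwist (F : ℝ → EuclideanSpace ℝ (Fin 3)) (L : ℝ) : UnitAddCircle :=
  (((2 * Real.pi)⁻¹ * ∫ t in (0 : ℝ)..L, torsion F t * ‖deriv F t‖ : ℝ) : UnitAddCircle)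

end

noncomputable section

/-! ### The Möbius group -/

/-! Everything is read off from one explicit Darboux frame. The Euclidean Frenet frame `T, N, B` and
curvature κ of `F` give a Darboux frame `E` of `χ ∘ F` (`euclideanDarboux`). With speed σ and
torsion τ, its Maurer-Cartan form (`euclideanMC`) has φ³₂ = στ and (φ⁰₂, φ⁰₃) = (κ', κστ).

Any other Darboux frame is `e = E g` with `g` an `adaptMatrix`: a scale l > 0, a shift a, and a
rotation (c, s) = (cos θ, sin θ) of the normal plane (`rel_eq_adaptMatrix`). From g' = gφ − ψg,
where φ and ψ are the forms of `e` and `E`, one gets (`rel_structure`) that l(φ⁰₂, φ⁰₃) is (κ', κστ)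
rotated by −θ, that φ³₂ = στ + θ', and that l' = lφ⁰₀ + aφ¹₀ with φ¹₀ = σl.

Hence 1-genericity means (κ', κστ) ≠ 0, and the Frenet conditions become (κ', κστ) = l²σ(c, s) and a
= l'/(lσ). These have exactly one solution, which is existence and uniqueness
(`frenetFrame_isFrenetFrame`, `eq_frenetFrame`). The functions c and s are expressions in the
periodic invariants σ, κ, τ, so θ changes by a multiple of 2π over a period (`winding_integral`).
The integrals of φ³₂ and στ therefore differ by that multiple.

Conformal invariance follows because left multiplication by a constant G carries Frenet frames of f
to Frenet frames of G·f with the same Maurer-Cartan form (`moebiusAct_frenet`). -/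

lemma lorentzMatrix_mul_self : lorentzMatrix * lorentzMatrix = 1 := by
  ext i j
  fin_cases i <;> fin_cases j <;> simp [lorentzMatrix, Matrix.mul_apply, Fin.sum_univ_five]

lemma lorentzForm_eq (v : HomCoord) :
    lorentzForm v = v 1 ^ 2 + v 2 ^ 2 + v 3 ^ 2 - 2 * (v 0 * v 4) := by
  simp [lorentzForm, lorentzMatrix, Matrix.mulVec, dotProduct, Fin.sum_univ_five]
  ring

lemma lorentz_dotProduct (v w : HomCoord) : v ⬝ᵥ (lorentzMatrix *ᵥ w) =
    v 1 * w 1 + v 2 * w 2 + v 3 * w 3 - (v 0 * w 4 + v 4 * w 0) := by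
  simp [lorentzMatrix, Matrix.mulVec, dotProduct, Fin.sum_univ_five]
  ring

/-- The inverse of a Lorentz transformation. -/
lemma lorentz_inv {G : Matrix (Fin 5) (Fin 5) ℝ} (hG : Gᵀ * lorentzMatrix * G = lorentzMatrix) :
    G⁻¹ = lorentzMatrix * Gᵀ * lorentzMatrix := by
  apply Matrix.inv_eq_left_inv
  rw [mul_assoc, mul_assoc, ← mul_assoc Gᵀ, hG, lorentzMatrix_mul_self]

lemma moebius_isUnit_det {G : Matrix (Fin 5) (Fin 5) ℝ} (hG : G ∈ moebiusGroup) :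
    IsUnit G.det := by
  rw [hG.2.1]; exact isUnit_one

lemma moebius_mul {G H : Matrix (Fin 5) (Fin 5) ℝ} (hG : G ∈ moebiusGroup)
    (hH : H ∈ moebiusGroup) : G * H ∈ moebiusGroup := by
  refine ⟨?_, ?_, fun v hv => ?_⟩
  · calc (G * H)ᵀ * lorentzMatrix * (G * H) = Hᵀ * (Gᵀ * lorentzMatrix * G) * H := by
          rw [Matrix.transpose_mul]; simp only [mul_assoc]
      _ = lorentzMatrix := by rw [hG.1, hH.1]
  · rw [Matrix.det_mul, hG.2.1, hH.2.1, one_mul]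
  · rw [← Matrix.mulVec_mulVec]
    exact hG.2.2 _ (hH.2.2 v hv)

lemma positiveLightCone_nonneg {v : HomCoord} (hv : v ∈ positiveLightCone) :
    0 ≤ v 0 ∧ 0 ≤ v 4 := by
  obtain ⟨h1, h2⟩ := hv
  rw [lorentzForm_eq] at h1
  have h3 : 0 ≤ v 0 * v 4 := by nlinarith [sq_nonneg (v 1), sq_nonneg (v 2), sq_nonneg (v 3)]
  constructor
  · by_contra h
    push Not at h
    nlinarith [mul_pos_of_neg_of_neg h h]
  · by_contra h
    push Not at h
    nlinarith [mul_pos_of_neg_of_neg h h]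

/-- Reverse Cauchy-Schwarz inequality on the positive light cone. -/
lemma positiveLightCone_product {x y : HomCoord} (hx : x ∈ positiveLightCone)
    (hy : y ∈ positiveLightCone) :
    x 1 * y 1 + x 2 * y 2 + x 3 * y 3 ≤ x 0 * y 4 + x 4 * y 0 := by
  obtain ⟨hx0, hx4⟩ := positiveLightCone_nonneg hx
  obtain ⟨hy0, hy4⟩ := positiveLightCone_nonneg hy
  have h1 := hx.1
  have h2 := hy.1
  rw [lorentzForm_eq] at h1 h2
  refine (abs_le_of_sq_le_sq' ?_ (by positivity)).2
  have hc : (x 1 * y 1 + x 2 * y 2 + x 3 * y 3) ^ 2 ≤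
      (x 1 ^ 2 + x 2 ^ 2 + x 3 ^ 2) * (y 1 ^ 2 + y 2 ^ 2 + y 3 ^ 2) := by
    nlinarith [sq_nonneg (x 1 * y 2 - x 2 * y 1), sq_nonneg (x 1 * y 3 - x 3 * y 1),
      sq_nonneg (x 2 * y 3 - x 3 * y 2)]
  have e1 : x 1 ^ 2 + x 2 ^ 2 + x 3 ^ 2 = 2 * (x 0 * x 4) := by linarith
  have e2 : y 1 ^ 2 + y 2 ^ 2 + y 3 ^ 2 = 2 * (y 0 * y 4) := by linarith
  rw [e1, e2] at hc
  nlinarith [sq_nonneg (x 0 * y 4 - x 4 * y 0)]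

/-- A Lorentz transformation of determinant one belongs to the Möbius group as soon as it maps the
first basis vector into the half-space containing the positive light cone. -/
lemma mem_moebiusGroup {G : Matrix (Fin 5) (Fin 5) ℝ}
    (hG : Gᵀ * lorentzMatrix * G = lorentzMatrix) (hdet : G.det = 1)
    (hpos : 0 < G 0 0 + G 4 0) : G ∈ moebiusGroup := by
  refine ⟨hG, hdet, fun v hv => ?_⟩
  have hprod : ∀ x y : HomCoord, (G *ᵥ x) ⬝ᵥ (lorentzMatrix *ᵥ (G *ᵥ y)) =
      x ⬝ᵥ (lorentzMatrix *ᵥ y) := by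
    intro x y
    calc _ = x ⬝ᵥ ((Gᵀ * lorentzMatrix * G) *ᵥ y) := by
          rw [← Matrix.mulVec_mulVec, ← Matrix.mulVec_mulVec, Matrix.dotProduct_mulVec x,
            Matrix.vecMul_transpose]
      _ = _ := by rw [hG]
  have hz : G *ᵥ Pi.single 0 1 = fun i => G i 0 := by
    ext i; simp
  have hzc : G *ᵥ Pi.single 0 1 ∈ positiveLightCone := by
    refine ⟨?_, by simpa [hz] using hpos⟩
    rw [lorentzForm, hprod]
    simp [lorentzMatrix]
  have hv4 := positiveLightCone_nonneg hv
  have hw : lorentzForm (G *ᵥ v) = 0 := by rw [lorentzForm, hprod]; exact hv.1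
  refine ⟨hw, ?_⟩
  by_contra hneg
  push Not at hneg
  have hwz := hprod v (Pi.single 0 1)
  rw [lorentz_dotProduct, lorentz_dotProduct v] at hwz
  simp only [Pi.single_eq_same, Pi.single_apply, Fin.reduceEq, if_false] at hwz
  set w := G *ᵥ v with hwdef
  set z := G *ᵥ Pi.single 0 1 with hzdef
  -- Write z for the image of the first basis vector. The pairing of w with z is −v⁴. If w⁰ + w⁴ <
  -- 0, then −w lies in the positive cone and reverse Cauchy-Schwarz makes this pairing nonnegative;
  -- if the sum is 0, then w = 0. Either way v⁴ = 0, so v is a positive multiple of the first basis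
  -- vector and w the same multiple of z, which contradicts `hpos`.
  have hv0 : v 4 = 0 := by
    rcases hneg.lt_or_eq with h | h
    · have hw' : -w ∈ positiveLightCone := by
        refine ⟨?_, ?_⟩
        · rw [lorentzForm_eq] at hw ⊢
          simp only [Pi.neg_apply]
          linarith
        · simp only [Pi.neg_apply]
          linarith
      have h2 := positiveLightCone_product hw' hzc
      simp only [Pi.neg_apply] at h2
      linarith
    · rw [lorentzForm_eq] at hw
      have h0 : w 4 = -w 0 := by linarith
      rw [h0] at hw
      have e0 : w 0 = 0 := by
        nlinarith [sq_nonneg (w 0), sq_nonneg (w 1), sq_nonneg (w 2), sq_nonneg (w 3)]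
      have e1 : w 1 = 0 := by
        nlinarith [sq_nonneg (w 0), sq_nonneg (w 1), sq_nonneg (w 2), sq_nonneg (w 3)]
      have e2 : w 2 = 0 := by
        nlinarith [sq_nonneg (w 0), sq_nonneg (w 1), sq_nonneg (w 2), sq_nonneg (w 3)]
      have e3 : w 3 = 0 := by
        nlinarith [sq_nonneg (w 0), sq_nonneg (w 1), sq_nonneg (w 2), sq_nonneg (w 3)]
      rw [h0, e0, e1, e2, e3] at hwz
      linarith
  have hvn := hv.1
  rw [lorentzForm_eq, hv0] at hvn
  have e1 : v 1 = 0 := by nlinarith [sq_nonneg (v 1), sq_nonneg (v 2), sq_nonneg (v 3)]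
  have e2 : v 2 = 0 := by nlinarith [sq_nonneg (v 1), sq_nonneg (v 2), sq_nonneg (v 3)]
  have e3 : v 3 = 0 := by nlinarith [sq_nonneg (v 1), sq_nonneg (v 2), sq_nonneg (v 3)]
  have hwi : ∀ i, w i = v 0 * G i 0 := by
    intro i
    simp [hwdef, Matrix.mulVec, dotProduct, Fin.sum_univ_five, e1, e2, e3, hv0, mul_comm]
  have hv00 : 0 < v 0 := by have := hv.2; linarith
  rw [hwi, hwi] at hneg
  nlinarith [mul_pos hv00 hpos]

/-! ### Derivatives of matrix valued maps -/

/-- Entrywise derivative of a matrix valued map. -/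
def HasMatDerivAt (e : ℝ → Matrix (Fin 5) (Fin 5) ℝ) (e' : Matrix (Fin 5) (Fin 5) ℝ)
    (t : ℝ) : Prop :=
  ∀ i j, HasDerivAt (fun u => e u i j) (e' i j) t

namespace HasMatDerivAt
variable {e h : ℝ → Matrix (Fin 5) (Fin 5) ℝ} {e' h' φ : Matrix (Fin 5) (Fin 5) ℝ} {t : ℝ}

lemma const (A : Matrix (Fin 5) (Fin 5) ℝ) (t : ℝ) : HasMatDerivAt (fun _ => A) 0 t :=
  fun _ _ => hasDerivAt_const _ _

lemma mul (he : HasMatDerivAt e e' t) (hh : HasMatDerivAt h h' t) :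
    HasMatDerivAt (fun u => e u * h u) (e' * h t + e t * h') t := by
  intro i j
  simp only [Matrix.mul_apply, Matrix.add_apply, ← Finset.sum_add_distrib]
  exact HasDerivAt.fun_sum fun k _ => (he i k).mul (hh k j)

lemma transpose (he : HasMatDerivAt e e' t) : HasMatDerivAt (fun u => (e u)ᵀ) e'ᵀ t :=
  fun i j => he j i

lemma unique (he : HasMatDerivAt e e' t) (he2 : HasMatDerivAt e h' t) : e' = h' := by
  ext i j
  exact (he i j).unique (he2 i j)

lemma congr_of_eventuallyEq (he : HasMatDerivAt e e' t) (hh : h =ᶠ[nhds t] e) :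
    HasMatDerivAt h e' t := fun i j =>
  (he i j).congr_of_eventuallyEq (hh.mono fun _ hu => congrFun (congrFun hu i) j)

lemma mcForm_eq (he : HasMatDerivAt e e' t) : mcForm e t = (e t)⁻¹ * e' := by
  unfold mcForm
  congr 1
  ext i j
  exact (he i j).deriv

lemma mcForm_eq_of_mul (he : HasMatDerivAt e (e t * φ) t) (hu : IsUnit (e t).det) :
    mcForm e t = φ := by
  rw [he.mcForm_eq, Matrix.nonsing_inv_mul_cancel_left _ _ hu]

end HasMatDerivAt

namespace IsFrame
variable {f : ℝ → ℙ ℝ HomCoord} {U : Set ℝ} {e : ℝ → Matrix (Fin 5) (Fin 5) ℝ} {t : ℝ}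

lemma hasMatDerivAt (he : IsFrame f U e) (hU : IsOpen U) (ht : t ∈ U) :
    HasMatDerivAt e (e t * mcForm e t) t := by
  intro i j
  unfold mcForm
  rw [Matrix.mul_nonsing_inv_cancel_left _ _ (moebius_isUnit_det (he.mem_moebius t ht))]
  exact (((he.smooth i j).contDiffAt (hU.mem_nhds ht)).differentiableAt (by simp)).hasDerivAt

/-- The Maurer-Cartan form takes values in the Lie algebra of the Lorentz group. -/
lemma mcForm_skew (he : IsFrame f U e) (hU : IsOpen U) (ht : t ∈ U) :
    (mcForm e t)ᵀ * lorentzMatrix + lorentzMatrix * mcForm e t = 0 := by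
  have h1 := he.hasMatDerivAt hU ht
  have h2 := (h1.transpose.mul (HasMatDerivAt.const lorentzMatrix t)).mul h1
  have h3 : HasMatDerivAt (fun u => (e u)ᵀ * lorentzMatrix * e u) 0 t := by
    apply (HasMatDerivAt.const lorentzMatrix t).congr_of_eventuallyEq
    filter_upwards [hU.mem_nhds ht] with u hu
    exact (he.mem_moebius u hu).1
  have h4 := h2.unique h3
  have h5 := (he.mem_moebius t ht).1
  rw [mul_zero, add_zero, Matrix.transpose_mul] at h4
  calc _ = (mcForm e t)ᵀ * ((e t)ᵀ * lorentzMatrix * e t) +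
        ((e t)ᵀ * lorentzMatrix * e t) * mcForm e t := by rw [h5]
    _ = 0 := by rw [← h4]; simp only [mul_assoc]

end IsFrame

/-! ### Euclidean Frenet-Serret theory -/

/-- A curve `F` in `ℝ³` with a positively oriented orthonormal moving frame `T, N, B` that satisfies
the Frenet-Serret equations with speed `σ`, curvature `κ` and torsion `τ`. -/
structure FrenetSerret (F T N B : ℝ → EuclideanSpace ℝ (Fin 3)) (σ κ τ : ℝ → ℝ) : Prop where
  speed_pos : ∀ t, 0 < σ t
  smooth_F : ∀ i, ContDiff ℝ ∞ fun t => F t i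
  smooth_T : ∀ i, ContDiff ℝ ∞ fun t => T t i
  smooth_N : ∀ i, ContDiff ℝ ∞ fun t => N t i
  smooth_B : ∀ i, ContDiff ℝ ∞ fun t => B t i
  smooth_speed : ContDiff ℝ ∞ σ
  smooth_curvature : ContDiff ℝ ∞ κ
  smooth_torsion : ContDiff ℝ ∞ τ
  deriv_F : ∀ i t, HasDerivAt (fun u => F u i) (σ t * T t i) t
  deriv_T : ∀ i t, HasDerivAt (fun u => T u i) (σ t * κ t * N t i) t
  deriv_N : ∀ i t, HasDerivAt (fun u => N u i) (σ t * (-(κ t * T t i) + τ t * B t i)) t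
  deriv_B : ∀ i t, HasDerivAt (fun u => B u i) (-(σ t * τ t * N t i)) t
  TT : ∀ t, T t 0 ^ 2 + T t 1 ^ 2 + T t 2 ^ 2 = 1
  NN : ∀ t, N t 0 ^ 2 + N t 1 ^ 2 + N t 2 ^ 2 = 1
  TN : ∀ t, T t 0 * N t 0 + T t 1 * N t 1 + T t 2 * N t 2 = 0
  B0 : ∀ t, B t 0 = T t 1 * N t 2 - T t 2 * N t 1
  B1 : ∀ t, B t 1 = T t 2 * N t 0 - T t 0 * N t 2
  B2 : ∀ t, B t 2 = T t 0 * N t 1 - T t 1 * N t 0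

/-- The matrix R with rows T, N, T × N satisfies R Rᵀ = 1. Being square, it also satisfies Rᵀ R = 1,
and this is the expansion. -/
lemma orthonormal_expansion {T N : Fin 3 → ℝ} (hTT : T ⬝ᵥ T = 1) (hNN : N ⬝ᵥ N = 1)
    (hTN : T ⬝ᵥ N = 0) (x : Fin 3 → ℝ) :
    x = (x ⬝ᵥ T) • T + (x ⬝ᵥ N) • N + (x ⬝ᵥ crossProduct T N) • crossProduct T N := by
  set R : Matrix (Fin 3) (Fin 3) ℝ := Matrix.of ![T, N, crossProduct T N] with hR
  have hNT : N ⬝ᵥ T = 0 := by rw [dotProduct_comm]; exact hTN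
  have h1 : R * Rᵀ = 1 := by
    have hB : crossProduct T N ⬝ᵥ crossProduct T N = 1 := by
      rw [cross_dot_cross, hTT, hNN, hTN]; norm_num
    have hTB := dot_self_cross T N
    have hNB := dot_cross_self T N
    have hBT : crossProduct T N ⬝ᵥ T = 0 := by rw [dotProduct_comm]; exact hTB
    have hBN : crossProduct T N ⬝ᵥ N = 0 := by rw [dotProduct_comm]; exact hNB
    ext i j
    change R i ⬝ᵥ R j = _
    fin_cases i <;> fin_cases j
    exacts [hTT, hTN, hTB, hNT, hNN, hNB, hBT, hBN, hB]
  have h2 : Rᵀ * R = 1 := mul_eq_one_comm.mp h1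
  calc x = (Rᵀ * R) *ᵥ x := by rw [h2, Matrix.one_mulVec]
    _ = Rᵀ *ᵥ (R *ᵥ x) := by rw [Matrix.mulVec_mulVec]
    _ = _ := by
      ext i
      simp [Matrix.mulVec, dotProduct, Fin.sum_univ_three, hR]
      ring

lemma contDiff_arcDeriv {X : ℝ → EuclideanSpace ℝ (Fin 3)} (hX : ContDiff ℝ ∞ X)
    {F : ℝ → EuclideanSpace ℝ (Fin 3)} (hF : ContDiff ℝ ∞ F) (h0 : ∀ t, deriv F t ≠ 0) :
    ContDiff ℝ ∞ (arcDeriv F X) := by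
  have h1 : ContDiff ℝ ∞ (deriv F) := (contDiff_infty_iff_deriv.mp hF).2
  have h2 : ContDiff ℝ ∞ (deriv X) := (contDiff_infty_iff_deriv.mp hX).2
  exact ((h1.norm ℝ h0).inv fun t => norm_ne_zero_iff.mpr (h0 t)).smul h2

/-- Differentiating the constant products ⟨T,T⟩, ⟨N,N⟩ and ⟨N,T⟩ yields T ⊥ N and the T and N
components of N'. The B component of N' is the torsion by definition, and B' follows from B = T × N.
-/
theorem frenetSerret {F : ℝ → EuclideanSpace ℝ (Fin 3)} (hF : ContDiff ℝ ∞ F)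
    (hk : ∀ t, curvature F t ≠ 0) :
    FrenetSerret F (unitTangent F) (principalNormal F) (binormal F) (fun t => ‖deriv F t‖)
      (curvature F) (torsion F) := by
  -- Since 0⁻¹ = 0, `arcDeriv` vanishes wherever the speed does, so nonvanishing curvature already
  -- forces `F` to be regular.
  have h0 : ∀ t, deriv F t ≠ 0 := by
    intro t h
    exact hk t (by simp [curvature, arcDeriv, h])
  have hn0 : ∀ t, ‖deriv F t‖ ≠ 0 := fun t => norm_ne_zero_iff.mpr (h0 t)
  have hσ : ContDiff ℝ ∞ (fun t => ‖deriv F t‖) := ((contDiff_infty_iff_deriv.mp hF).2).norm ℝ h0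
  have hT : ContDiff ℝ ∞ (unitTangent F) := contDiff_arcDeriv hF hF h0
  have hA : ContDiff ℝ ∞ (arcDeriv F (unitTangent F)) := contDiff_arcDeriv hT hF h0
  have hκ : ContDiff ℝ ∞ (curvature F) := hA.norm ℝ fun t => norm_ne_zero_iff.mp (hk t)
  have hN : ContDiff ℝ ∞ (principalNormal F) := (hκ.inv hk).smul hA
  have hco : ∀ {X : ℝ → EuclideanSpace ℝ (Fin 3)}, ContDiff ℝ ∞ X → ∀ i,
      ContDiff ℝ ∞ fun t => X t i := fun hX i => (contDiff_euclidean.mp hX) i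
  have hB : ContDiff ℝ ∞ (binormal F) := by
    rw [contDiff_euclidean]
    intro i
    have hTc := hco hT
    have hNc := hco hN
    fin_cases i <;> simp only [binormal, cross_apply] <;>
    · simp
      fun_prop
  have hA2 : ContDiff ℝ ∞ (arcDeriv F (principalNormal F)) := contDiff_arcDeriv hN hF h0
  have hτ : ContDiff ℝ ∞ (torsion F) := hA2.inner ℝ hB
  have dd : ∀ {X : ℝ → EuclideanSpace ℝ (Fin 3)}, ContDiff ℝ ∞ X → ∀ t,
      HasDerivAt X (deriv X t) t :=
    fun hX t => ((hX.differentiable (by simp)) t).hasDerivAt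
  have nT : ∀ t, ‖unitTangent F t‖ = 1 := by
    intro t
    rw [unitTangent, arcDeriv, norm_smul, norm_inv, norm_norm, inv_mul_cancel₀ (hn0 t)]
  have nN : ∀ t, ‖principalNormal F t‖ = 1 := by
    intro t
    rw [principalNormal, norm_smul, norm_inv, Real.norm_eq_abs,
      abs_of_nonneg (show 0 ≤ curvature F t from norm_nonneg _)]
    exact inv_mul_cancel₀ (hk t)
  have dF : ∀ t, deriv F t = ‖deriv F t‖ • unitTangent F t := by
    intro t
    rw [unitTangent, arcDeriv, smul_smul, mul_inv_cancel₀ (hn0 t), one_smul]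
  have dT : ∀ t, deriv (unitTangent F) t =
      (‖deriv F t‖ * curvature F t) • principalNormal F t := by
    intro t
    rw [principalNormal, arcDeriv, smul_smul, smul_smul]
    have : ‖deriv F t‖ * curvature F t * (curvature F t)⁻¹ * ‖deriv F t‖⁻¹ = 1 := by
      have := hk t
      have := hn0 t
      field_simp
    simp only [this, one_smul]
  have iT : ∀ t, inner ℝ (unitTangent F t) (unitTangent F t) = (1 : ℝ) := fun t => by
    rw [real_inner_self_eq_norm_sq, nT, one_pow]
  have iN : ∀ t, inner ℝ (principalNormal F t) (principalNormal F t) = (1 : ℝ) := fun t => by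
    rw [real_inner_self_eq_norm_sq, nN, one_pow]
  have iTN : ∀ t, inner ℝ (unitTangent F t) (principalNormal F t) = (0 : ℝ) := by
    intro t
    have h1 := (dd hT t).inner ℝ (dd hT t)
    simp only [iT] at h1
    have h2 := h1.unique (hasDerivAt_const t (1 : ℝ))
    rw [dT, inner_smul_right, inner_smul_left, real_inner_comm (unitTangent F t)] at h2
    simp only [conj_trivial] at h2
    have h3 : ‖deriv F t‖ * curvature F t ≠ 0 := mul_ne_zero (hn0 t) (hk t)
    have h4 : (‖deriv F t‖ * curvature F t) *
      inner ℝ (unitTangent F t) (principalNormal F t) = 0 := by linarith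
    exact (mul_eq_zero.mp h4).resolve_left h3
  have dNN : ∀ t, inner ℝ (deriv (principalNormal F) t) (principalNormal F t) = (0 : ℝ) := by
    intro t
    have h1 := (dd hN t).inner ℝ (dd hN t)
    simp only [iN] at h1
    have h2 := h1.unique (hasDerivAt_const t (1 : ℝ))
    rw [real_inner_comm (deriv (principalNormal F) t)] at h2
    linarith
  have dNT : ∀ t, inner ℝ (deriv (principalNormal F) t) (unitTangent F t) =
      -(‖deriv F t‖ * curvature F t) := by
    intro t
    have h1 := (dd hN t).inner ℝ (dd hT t)
    simp only [real_inner_comm (unitTangent F _), iTN] at h1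
    have h2 := h1.unique (hasDerivAt_const t (0 : ℝ))
    rw [dT, inner_smul_right, iN, real_inner_comm (deriv (principalNormal F) t)] at h2
    linarith
  have dNB : ∀ t, inner ℝ (deriv (principalNormal F) t) (binormal F t) =
      ‖deriv F t‖ * torsion F t := by
    intro t
    rw [torsion, arcDeriv, inner_smul_left]
    simp only [conj_trivial]
    rw [← mul_assoc, mul_inv_cancel₀ (hn0 t), one_mul]
  have idot : ∀ x y : EuclideanSpace ℝ (Fin 3), inner ℝ x y = x.ofLp ⬝ᵥ y.ofLp := by
    intro x y
    rw [real_inner_comm]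
    simp [PiLp.inner_apply, dotProduct]
  have dN : ∀ t, deriv (principalNormal F) t =
      ‖deriv F t‖ • (-curvature F t • unitTangent F t + torsion F t • binormal F t) := by
    intro t
    have h := orthonormal_expansion (by rw [← idot]; exact iT t) (by rw [← idot]; exact iN t)
      (by rw [← idot]; exact iTN t) (deriv (principalNormal F) t).ofLp
    rw [← idot, ← idot, dNT, dNN] at h
    have h3 : (deriv (principalNormal F) t).ofLp ⬝ᵥ
        crossProduct (unitTangent F t).ofLp (principalNormal F t).ofLp =
        ‖deriv F t‖ * torsion F t := by
      rw [← dNB, idot]; rfl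
    rw [h3] at h
    ext i
    rw [h]
    simp [binormal]
    ring
  have cTT : ∀ t, unitTangent F t 0 ^ 2 + unitTangent F t 1 ^ 2 + unitTangent F t 2 ^ 2 = 1 := by
    intro t
    rw [← iT t, idot, dotProduct, Fin.sum_univ_three]; ring
  have cNN : ∀ t, principalNormal F t 0 ^ 2 + principalNormal F t 1 ^ 2 +
      principalNormal F t 2 ^ 2 = 1 := by
    intro t
    rw [← iN t, idot, dotProduct, Fin.sum_univ_three]; ring
  have cTN : ∀ t, unitTangent F t 0 * principalNormal F t 0 +
      unitTangent F t 1 * principalNormal F t 1 +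
      unitTangent F t 2 * principalNormal F t 2 = 0 := by
    intro t
    rw [← iTN t, idot, dotProduct, Fin.sum_univ_three]
  have cd : ∀ {X : ℝ → EuclideanSpace ℝ (Fin 3)} {X' t}, HasDerivAt X X' t → ∀ i,
      HasDerivAt (fun u => X u i) (X' i) t := 
    fun h i =>
      (EuclideanSpace.proj i : EuclideanSpace ℝ (Fin 3) →L[ℝ] ℝ).hasFDerivAt.comp_hasDerivAt _ h
  have eT : ∀ i t, HasDerivAt (fun u => unitTangent F u i)
      (‖deriv F t‖ * curvature F t * principalNormal F t i) t :=
    fun i t => cd (dT t ▸ dd hT t) i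
  have eN : ∀ i t, HasDerivAt (fun u => principalNormal F u i)
      (‖deriv F t‖ * (-(curvature F t * unitTangent F t i) + torsion F t * binormal F t i)) t :=
    fun i t => (cd (dN t ▸ dd hN t) i).congr_deriv (by simp [mul_add])
  have B0 : ∀ t, binormal F t 0 = unitTangent F t 1 * principalNormal F t 2 -
      unitTangent F t 2 * principalNormal F t 1 := fun t => by simp [binormal, cross_apply]
  have B1 : ∀ t, binormal F t 1 = unitTangent F t 2 * principalNormal F t 0 -
      unitTangent F t 0 * principalNormal F t 2 := fun t => by simp [binormal, cross_apply]
  have B2 : ∀ t, binormal F t 2 = unitTangent F t 0 * principalNormal F t 1 -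
      unitTangent F t 1 * principalNormal F t 0 := fun t => by simp [binormal, cross_apply]
  refine
    { speed_pos := fun t => norm_pos_iff.mpr (h0 t), smooth_F := hco hF, smooth_T := hco hT
      smooth_N := hco hN, smooth_B := hco hB, smooth_speed := hσ, smooth_curvature := hκ
      smooth_torsion := hτ
      deriv_F := fun i t => cd (dF t ▸ dd hF t) i
      deriv_T := eT, deriv_N := eN, deriv_B := fun i t => ?_
      TT := cTT, NN := cNN, TN := cTN, B0 := B0, B1 := B1, B2 := B2 }
  -- B' = T' × N + T × N' = στ T × B, the κ terms dropping out, and T × (T × N) = (T·N)T − (T·T)N.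
  -- The coefficients below are those of this identity.
  have eTT := cTT t
  have eTN := cTN t
  fin_cases i
  · change HasDerivAt (fun u => binormal F u 0)
      (-(‖deriv F t‖ * torsion F t * principalNormal F t 0)) t
    simp only [B0]
    refine (((eT 1 t).mul (eN 2 t)).sub ((eT 2 t).mul (eN 1 t))).congr_deriv ?_
    rw [B1, B2]
    linear_combination (-‖deriv F t‖ * torsion F t * principalNormal F t 0) * eTT +
      (‖deriv F t‖ * torsion F t * unitTangent F t 0) * eTN
  · change HasDerivAt (fun u => binormal F u 1)
      (-(‖deriv F t‖ * torsion F t * principalNormal F t 1)) t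
    simp only [B1]
    refine (((eT 2 t).mul (eN 0 t)).sub ((eT 0 t).mul (eN 2 t))).congr_deriv ?_
    rw [B0, B2]
    linear_combination (-‖deriv F t‖ * torsion F t * principalNormal F t 1) * eTT +
      (‖deriv F t‖ * torsion F t * unitTangent F t 1) * eTN
  · change HasDerivAt (fun u => binormal F u 2)
      (-(‖deriv F t‖ * torsion F t * principalNormal F t 2)) t
    simp only [B2]
    refine (((eT 0 t).mul (eN 1 t)).sub ((eT 1 t).mul (eN 0 t))).congr_deriv ?_
    rw [B0, B1]
    linear_combination (-‖deriv F t‖ * torsion F t * principalNormal F t 2) * eTT +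
      (‖deriv F t‖ * torsion F t * unitTangent F t 2) * eTN

/-! ### The Euclidean Darboux frame -/

/-- The Darboux frame of `χ ∘ F` built from a Euclidean Frenet frame `T, N, B` of `F` and
the curvature `k` at the point `x` of the curve. -/
def euclideanDarboux (x T N B : Fin 3 → ℝ) (k : ℝ) : Matrix (Fin 5) (Fin 5) ℝ :=
  !![1, 0, k, 0, k ^ 2 / 2;
     x 0, T 0, N 0 + k * x 0, B 0, k * N 0 + k ^ 2 / 2 * x 0;
     x 1, T 1, N 1 + k * x 1, B 1, k * N 1 + k ^ 2 / 2 * x 1;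
     x 2, T 2, N 2 + k * x 2, B 2, k * N 2 + k ^ 2 / 2 * x 2;
     (x 0 ^ 2 + x 1 ^ 2 + x 2 ^ 2) / 2, T 0 * x 0 + T 1 * x 1 + T 2 * x 2,
       N 0 * x 0 + N 1 * x 1 + N 2 * x 2 + k * ((x 0 ^ 2 + x 1 ^ 2 + x 2 ^ 2) / 2),
       B 0 * x 0 + B 1 * x 1 + B 2 * x 2,
       1 + k * (N 0 * x 0 + N 1 * x 1 + N 2 * x 2) +
         k ^ 2 / 2 * ((x 0 ^ 2 + x 1 ^ 2 + x 2 ^ 2) / 2)]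

/-- The Maurer-Cartan matrix of the Euclidean Darboux frame. -/
def euclideanMC (σ κ κ' τ : ℝ) : Matrix (Fin 5) (Fin 5) ℝ :=
  !![0, -(σ * κ ^ 2 / 2), κ', κ * σ * τ, 0;
     σ, 0, 0, 0, -(σ * κ ^ 2 / 2);
     0, 0, 0, -(σ * τ), κ';
     0, 0, σ * τ, 0, κ * σ * τ;
     0, σ, 0, 0, 0]

lemma orthonormal_det {T N B : Fin 3 → ℝ} (hTT : T 0 ^ 2 + T 1 ^ 2 + T 2 ^ 2 = 1)
    (hNN : N 0 ^ 2 + N 1 ^ 2 + N 2 ^ 2 = 1) (hTN : T 0 * N 0 + T 1 * N 1 + T 2 * N 2 = 0)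
    (hB0 : B 0 = T 1 * N 2 - T 2 * N 1) (hB1 : B 1 = T 2 * N 0 - T 0 * N 2)
    (hB2 : B 2 = T 0 * N 1 - T 1 * N 0) :
    T 0 * B 0 + T 1 * B 1 + T 2 * B 2 = 0 ∧ N 0 * B 0 + N 1 * B 1 + N 2 * B 2 = 0 ∧
      B 0 ^ 2 + B 1 ^ 2 + B 2 ^ 2 = 1 := by
  rw [hB0, hB1, hB2]
  refine ⟨by ring, by ring, ?_⟩
  -- Lagrange's identity |T × N|² = |T|²|N|² − (T·N)².
  linear_combination (N 0 ^ 2 + N 1 ^ 2 + N 2 ^ 2) * hTT + hNN -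
    (T 0 * N 0 + T 1 * N 1 + T 2 * N 2) * hTN

/-- With X = `chiVec x`, dχ the differential of `chiVec` at x, and P = (0,0,0,0,1), the columns are
X, dχ(T), dχ(N) + kX, dχ(B) and P + k dχ(N) + (k²/2)X. The case k = 0 is the lift of a Euclidean
frame, and the k terms are a null rotation fixing X. The determinant is that of (T, N, B). -/
lemma euclideanDarboux_mem {x T N B : Fin 3 → ℝ} (k : ℝ)
    (hTT : T 0 ^ 2 + T 1 ^ 2 + T 2 ^ 2 = 1)
    (hNN : N 0 ^ 2 + N 1 ^ 2 + N 2 ^ 2 = 1) (hTN : T 0 * N 0 + T 1 * N 1 + T 2 * N 2 = 0)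
    (hB0 : B 0 = T 1 * N 2 - T 2 * N 1) (hB1 : B 1 = T 2 * N 0 - T 0 * N 2)
    (hB2 : B 2 = T 0 * N 1 - T 1 * N 0) : euclideanDarboux x T N B k ∈ moebiusGroup := by
  obtain ⟨hTB, hNB, hBB⟩ := orthonormal_det hTT hNN hTN hB0 hB1 hB2
  have hdet : (euclideanDarboux x T N B k).det = B 0 * (T 1 * N 2 - T 2 * N 1) +
      B 1 * (T 2 * N 0 - T 0 * N 2) + B 2 * (T 0 * N 1 - T 1 * N 0) := by
    simp [euclideanDarboux, Matrix.det_succ_row_zero, Fin.sum_univ_succ, Fin.succAbove]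
    ring
  rw [← hB0, ← hB1, ← hB2, ← pow_two, ← pow_two, ← pow_two] at hdet
  refine mem_moebiusGroup ?_ (hdet.trans hBB) ?_
  · ext i j
    fin_cases i <;> fin_cases j <;>
      simp [lorentzMatrix, euclideanDarboux, Matrix.mul_apply, Fin.sum_univ_five]
    all_goals grind
  · simp [euclideanDarboux]
    positivity

lemma chiVec_eq (F : EuclideanSpace ℝ (Fin 3)) :
    chiVec F = ![1, F 0, F 1, F 2, (F 0 ^ 2 + F 1 ^ 2 + F 2 ^ 2) / 2] := by
  simp [chiVec, EuclideanSpace.norm_sq_eq, Fin.sum_univ_three]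

namespace FrenetSerret
variable {F T N B : ℝ → EuclideanSpace ℝ (Fin 3)} {σ κ τ : ℝ → ℝ}

lemma darboux_mem (h : FrenetSerret F T N B σ κ τ) (t : ℝ) :
    euclideanDarboux (F t) (T t) (N t) (B t) (κ t) ∈ moebiusGroup :=
  euclideanDarboux_mem _ (h.TT t) (h.NN t) (h.TN t) (h.B0 t) (h.B1 t) (h.B2 t)

lemma darboux_smooth (h : FrenetSerret F T N B σ κ τ) (i j : Fin 5) :
    ContDiff ℝ ∞ fun t => euclideanDarboux (F t) (T t) (N t) (B t) (κ t) i j := by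
  have hF := h.smooth_F
  have hT := h.smooth_T
  have hN := h.smooth_N
  have hB := h.smooth_B
  have hκ := h.smooth_curvature
  fin_cases i <;> fin_cases j <;> simp [euclideanDarboux] <;> fun_prop

/-- The second derivative of the lift contributes σκ dχ(N) + σP to the derivative of the column
dχ(T). Choosing k = κ absorbs the normal part into the last column, so φ²₁ = 0 and the frame is
Darboux. -/
lemma darboux_deriv (h : FrenetSerret F T N B σ κ τ) (t : ℝ) :
    HasMatDerivAt (fun t => euclideanDarboux (F t) (T t) (N t) (B t) (κ t))
      (euclideanDarboux (F t) (T t) (N t) (B t) (κ t) *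
        euclideanMC (σ t) (κ t) (deriv κ t) (τ t)) t := by
  have hF := fun i => h.deriv_F i t
  have hT := fun i => h.deriv_T i t
  have hN := fun i => h.deriv_N i t
  have hB := fun i => h.deriv_B i t
  have hκ : HasDerivAt κ (deriv κ t) t :=
    ((h.smooth_curvature.differentiable (by simp)) t).hasDerivAt
  have hTT := h.TT t
  have hNN := h.NN t
  have hTN := h.TN t
  obtain ⟨hTB, hNB, hBB⟩ := orthonormal_det hTT hNN hTN (h.B0 t) (h.B1 t) (h.B2 t)
  have hQ : HasDerivAt (fun u => (F u 0 ^ 2 + F u 1 ^ 2 + F u 2 ^ 2) / 2)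
      (σ t * (T t 0 * F t 0 + T t 1 * F t 1 + T t 2 * F t 2)) t :=
    (((((hF 0).pow 2).add ((hF 1).pow 2)).add ((hF 2).pow 2)).div_const 2).congr_deriv
      (by norm_num; ring)
  have hTF : HasDerivAt (fun u => T u 0 * F u 0 + T u 1 * F u 1 + T u 2 * F u 2)
      (σ t * κ t * (N t 0 * F t 0 + N t 1 * F t 1 + N t 2 * F t 2) + σ t) t :=
    ((((hT 0).mul (hF 0)).add ((hT 1).mul (hF 1))).add ((hT 2).mul (hF 2))).congr_deriv
      (by linear_combination σ t * hTT)
  have hNF : HasDerivAt (fun u => N u 0 * F u 0 + N u 1 * F u 1 + N u 2 * F u 2)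
      (σ t * (-(κ t * (T t 0 * F t 0 + T t 1 * F t 1 + T t 2 * F t 2)) +
        τ t * (B t 0 * F t 0 + B t 1 * F t 1 + B t 2 * F t 2))) t :=
    ((((hN 0).mul (hF 0)).add ((hN 1).mul (hF 1))).add ((hN 2).mul (hF 2))).congr_deriv
      (by linear_combination σ t * hTN)
  have hBF : HasDerivAt (fun u => B u 0 * F u 0 + B u 1 * F u 1 + B u 2 * F u 2)
      (-(σ t * τ t * (N t 0 * F t 0 + N t 1 * F t 1 + N t 2 * F t 2))) t :=
    ((((hB 0).mul (hF 0)).add ((hB 1).mul (hF 1))).add ((hB 2).mul (hF 2))).congr_deriv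
      (by linear_combination σ t * hTB)
  have hκ2 : HasDerivAt (fun u => κ u ^ 2 / 2) (κ t * deriv κ t) t :=
    ((hκ.pow 2).div_const 2).congr_deriv (by norm_num; ring)
  have h2 := fun i => (hN i).add (hκ.mul (hF i))
  have h4 := fun i => (hκ.mul (hN i)).add (hκ2.mul (hF i))
  have hc := fun c : ℝ => hasDerivAt_const t c
  have key : ∀ i j, ∃ d, HasDerivAt
      (fun u => euclideanDarboux (F u) (T u) (N u) (B u) (κ u) i j) d t ∧
      d = (euclideanDarboux (F t) (T t) (N t) (B t) (κ t) *
        euclideanMC (σ t) (κ t) (deriv κ t) (τ t)) i j := by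
    intro i j
    fin_cases i <;> fin_cases j
    · exact ⟨_, hc 1, by
        simp [euclideanMC, euclideanDarboux, Matrix.mul_apply, Fin.sum_univ_five]⟩
    · exact ⟨_, hc 0, by
        simp [euclideanMC, euclideanDarboux, Matrix.mul_apply, Fin.sum_univ_five]; ring⟩
    · exact ⟨_, hκ, by
        simp [euclideanMC, euclideanDarboux, Matrix.mul_apply, Fin.sum_univ_five]⟩
    · exact ⟨_, hc 0, by
        simp [euclideanMC, euclideanDarboux, Matrix.mul_apply, Fin.sum_univ_five]; ring⟩
    · exact ⟨_, hκ2, by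
        simp [euclideanMC, euclideanDarboux, Matrix.mul_apply, Fin.sum_univ_five]⟩
    · exact ⟨_, hF 0, by
        simp [euclideanMC, euclideanDarboux, Matrix.mul_apply, Fin.sum_univ_five]; ring⟩
    · exact ⟨_, hT 0, by
        simp [euclideanMC, euclideanDarboux, Matrix.mul_apply, Fin.sum_univ_five]; ring⟩
    · exact ⟨_, h2 0, by
        simp [euclideanMC, euclideanDarboux, Matrix.mul_apply, Fin.sum_univ_five]; ring⟩
    · exact ⟨_, hB 0, by
        simp [euclideanMC, euclideanDarboux, Matrix.mul_apply, Fin.sum_univ_five]; ring⟩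
    · exact ⟨_, h4 0, by
        simp [euclideanMC, euclideanDarboux, Matrix.mul_apply, Fin.sum_univ_five]; ring⟩
    · exact ⟨_, hF 1, by
        simp [euclideanMC, euclideanDarboux, Matrix.mul_apply, Fin.sum_univ_five]; ring⟩
    · exact ⟨_, hT 1, by
        simp [euclideanMC, euclideanDarboux, Matrix.mul_apply, Fin.sum_univ_five]; ring⟩
    · exact ⟨_, h2 1, by
        simp [euclideanMC, euclideanDarboux, Matrix.mul_apply, Fin.sum_univ_five]; ring⟩
    · exact ⟨_, hB 1, by
        simp [euclideanMC, euclideanDarboux, Matrix.mul_apply, Fin.sum_univ_five]; ring⟩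
    · exact ⟨_, h4 1, by
        simp [euclideanMC, euclideanDarboux, Matrix.mul_apply, Fin.sum_univ_five]; ring⟩
    · exact ⟨_, hF 2, by
        simp [euclideanMC, euclideanDarboux, Matrix.mul_apply, Fin.sum_univ_five]; ring⟩
    · exact ⟨_, hT 2, by
        simp [euclideanMC, euclideanDarboux, Matrix.mul_apply, Fin.sum_univ_five]; ring⟩
    · exact ⟨_, h2 2, by
        simp [euclideanMC, euclideanDarboux, Matrix.mul_apply, Fin.sum_univ_five]; ring⟩
    · exact ⟨_, hB 2, by
        simp [euclideanMC, euclideanDarboux, Matrix.mul_apply, Fin.sum_univ_five]; ring⟩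
    · exact ⟨_, h4 2, by
        simp [euclideanMC, euclideanDarboux, Matrix.mul_apply, Fin.sum_univ_five]; ring⟩
    · exact ⟨_, hQ, by
        simp [euclideanMC, euclideanDarboux, Matrix.mul_apply, Fin.sum_univ_five]; ring⟩
    · exact ⟨_, hTF, by
        simp [euclideanMC, euclideanDarboux, Matrix.mul_apply, Fin.sum_univ_five]; ring⟩
    · exact ⟨_, hNF.add (hκ.mul hQ), by
        simp [euclideanMC, euclideanDarboux, Matrix.mul_apply, Fin.sum_univ_five]; ring⟩
    · exact ⟨_, hBF, by
        simp [euclideanMC, euclideanDarboux, Matrix.mul_apply, Fin.sum_univ_five]; ring⟩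
    · exact ⟨_, ((hκ.mul hNF).const_add 1).add (hκ2.mul hQ), by
        simp [euclideanMC, euclideanDarboux, Matrix.mul_apply, Fin.sum_univ_five]; ring⟩
  intro i j
  obtain ⟨d, hd, rfl⟩ := key i j
  exact hd

end FrenetSerret

/-! ### Darboux frames relative to the Euclidean Darboux frame -/

/-- The change of frame between two Darboux frames. -/
def adaptMatrix (l a c s : ℝ) : Matrix (Fin 5) (Fin 5) ℝ :=
  !![l, a, 0, 0, a ^ 2 / (2 * l);
     0, 1, 0, 0, a / l;
     0, 0, c, -s, 0;
     0, 0, s, c, 0;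
     0, 0, 0, 0, l⁻¹]

/-- The hypothesis says that `lorentzMatrix * φ` is antisymmetric. -/
lemma skew_entries {φ : Matrix (Fin 5) (Fin 5) ℝ}
    (h : φᵀ * lorentzMatrix + lorentzMatrix * φ = 0) :
    φ 4 0 = 0 ∧ φ 4 1 = φ 1 0 ∧ φ 4 2 = φ 2 0 ∧ φ 4 3 = φ 3 0 ∧ φ 1 1 = 0 ∧ φ 2 2 = 0 ∧
      φ 3 3 = 0 ∧ φ 1 2 = -φ 2 1 ∧ φ 1 3 = -φ 3 1 ∧ φ 2 3 = -φ 3 2 := by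
  have H := fun i j => congrFun (congrFun h i) j
  have h00 := H 0 0
  have h01 := H 0 1
  have h02 := H 0 2
  have h03 := H 0 3
  have h11 := H 1 1
  have h22 := H 2 2
  have h33 := H 3 3
  have h12 := H 1 2
  have h13 := H 1 3
  have h23 := H 2 3
  simp [lorentzMatrix, Matrix.mul_apply, Matrix.vecMul, dotProduct,
    Fin.sum_univ_five] at h00 h01 h02 h03 h11 h22 h33 h12 h13 h23
  refine ⟨?_, ?_, ?_, ?_, ?_, ?_, ?_, ?_, ?_, ?_⟩ <;> linarith

lemma euclideanMC_skew (σ κ κ' τ : ℝ) :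
    (euclideanMC σ κ κ' τ)ᵀ * lorentzMatrix + lorentzMatrix * euclideanMC σ κ κ' τ = 0 := by
  ext i j
  fin_cases i <;> fin_cases j <;>
    simp [lorentzMatrix, euclideanMC, Matrix.mul_apply, Fin.sum_univ_five]

/-- The derivative of the change of frame between two moving frames. -/
lemma HasMatDerivAt.relative {E e : ℝ → Matrix (Fin 5) (Fin 5) ℝ}
    {ψ φ : Matrix (Fin 5) (Fin 5) ℝ} {t : ℝ} (hE : HasMatDerivAt E (E t * ψ) t)
    (he : HasMatDerivAt e (e t * φ) t) (hψ : ψᵀ * lorentzMatrix + lorentzMatrix * ψ = 0) :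
    HasMatDerivAt (fun u => lorentzMatrix * (E u)ᵀ * lorentzMatrix * e u)
      (lorentzMatrix * (E t)ᵀ * lorentzMatrix * e t * φ -
        ψ * (lorentzMatrix * (E t)ᵀ * lorentzMatrix * e t)) t := by
  -- For a Lorentz matrix E, the product J Eᵀ J with J = `lorentzMatrix` is E⁻¹. It is linear in E,
  -- so no inverse has to be differentiated.
  have h1 := ((((HasMatDerivAt.const lorentzMatrix t).mul hE.transpose).mul
    (HasMatDerivAt.const lorentzMatrix t)).mul he)
  have h2 : lorentzMatrix * ψᵀ = -ψ * lorentzMatrix := by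
    have h3 : ψᵀ * lorentzMatrix = -(lorentzMatrix * ψ) := eq_neg_of_add_eq_zero_left hψ
    calc lorentzMatrix * ψᵀ = lorentzMatrix * (ψᵀ * lorentzMatrix) * lorentzMatrix := by
          rw [mul_assoc, mul_assoc, lorentzMatrix_mul_self, mul_one]
      _ = _ := by
          rw [h3, mul_neg, ← mul_assoc, lorentzMatrix_mul_self, one_mul]
  convert h1 using 1
  rw [Matrix.transpose_mul, ← mul_assoc lorentzMatrix, h2]
  simp only [zero_mul, zero_add, mul_zero, add_zero, neg_mul, mul_assoc]
  abel

/-- The first column of a frame along `χ ∘ F`. -/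
lemma IsFrame.col_zero {f : ℝ → ℙ ℝ HomCoord} {U : Set ℝ} {e : ℝ → Matrix (Fin 5) (Fin 5) ℝ}
    (he : IsFrame f U e) {t : ℝ} (ht : t ∈ U) {x : EuclideanSpace ℝ (Fin 3)}
    (hx : f t = chi x) : 0 < e t 0 0 ∧ ∀ i, e t i 0 = e t 0 0 * chiVec x i := by
  obtain ⟨h0, h1⟩ := he.proj t ht
  rw [hx, chi, Projectivization.mk_eq_mk_iff'] at h1
  obtain ⟨a, ha⟩ := h1
  have ha' : ∀ i, e t i 0 = a * chiVec x i := fun i => (congrFun ha i).symm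
  have ha0 : e t 0 0 = a := by rw [ha']; simp [chiVec]
  refine ⟨?_, fun i => by rw [ha0, ha']⟩
  -- The projective point determines the scale only up to a nonzero factor. Its sign comes from the
  -- positive cone, which contains the first basis vector and hence the first column of the frame.
  have hc := (he.mem_moebius t ht).2.2 (Pi.single 0 1) (by
    constructor
    · rw [lorentzForm_eq]; simp
    · simp)
  have h2 := (positiveLightCone_nonneg hc).1
  simp at h2
  refine lt_of_le_of_ne h2 fun h3 => h0 ?_
  ext i
  change e t i 0 = 0
  rw [ha', ← ha0, ← h3, zero_mul]

/-- A Lorentz transformation of determinant one which respects the partial flag of the Darboux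
frames is an `adaptMatrix`. -/
lemma eq_adaptMatrix {g : Matrix (Fin 5) (Fin 5) ℝ} {l : ℝ}
    (hg : gᵀ * lorentzMatrix * g = lorentzMatrix) (hdet : g.det = 1) (hl : 0 < l)
    (h00 : g 0 0 = l) (h10 : g 1 0 = 0) (h20 : g 2 0 = 0) (h30 : g 3 0 = 0) (h40 : g 4 0 = 0)
    (h11 : g 1 1 = 1) (h21 : g 2 1 = 0) (h31 : g 3 1 = 0) (h41 : g 4 1 = 0)
    (h24 : g 2 4 = 0) (h34 : g 3 4 = 0) :
    g = adaptMatrix l (g 0 1) (g 2 2) (g 3 2) ∧ g 2 2 ^ 2 + g 3 2 ^ 2 = 1 := by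
  have H := fun i j => congrFun (congrFun hg i) j
  have e02 := H 0 2
  have e03 := H 0 3
  have e04 := H 0 4
  have e12 := H 1 2
  have e13 := H 1 3
  have e14 := H 1 4
  have e24 := H 2 4
  have e34 := H 3 4
  have e44 := H 4 4
  have e22 := H 2 2
  have e23 := H 2 3
  simp [lorentzMatrix, Matrix.mul_apply, Fin.sum_univ_five, h00, h10, h20, h30, h40, h11, h21, h31,
    h41, h24, h34, hl.ne'] at e02 e03 e04 e12 e13 e14 e24 e34 e44 e22 e23
  have h44 : g 4 4 = l⁻¹ := eq_inv_of_mul_eq_one_right e04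
  simp [e02, e03, h44] at e12 e13 e24 e34 e44 e22 e23 e14
  simp [e12, e13, hl.ne'] at e24 e34 e44 e22 e23 e14
  have h14 : g 1 4 = g 0 1 / l := by
    rw [div_eq_mul_inv]; linarith
  have h04 : g 0 4 = g 0 1 ^ 2 / (2 * l) := by
    rw [h14] at e44
    field_simp at e44 ⊢
    linarith
  have h22 : g 2 2 ^ 2 + g 3 2 ^ 2 = 1 := by linarith
  -- The determinant of g is l · 1 · l⁻¹ times that of the middle 2×2 block. The block is thus
  -- orthogonal of determinant 1, that is, a rotation.
  have hd : g 2 2 * g 3 3 - g 3 2 * g 2 3 = 1 := by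
    rw [← hdet]
    simp [Matrix.det_succ_column_zero, Fin.sum_univ_succ, Fin.succAbove, h00, h10, h20, h30, h40,
      h11, h21, h31, h41, e02, e03, h44]
    field_simp
    ring
  have h33 : g 3 3 = g 2 2 := by
    linear_combination (-g 3 3) * h22 + g 2 2 * hd + g 3 2 * e23
  have h23 : g 2 3 = -g 3 2 := by
    linear_combination (-g 2 3) * h22 - g 3 2 * hd + g 2 2 * e23
  refine ⟨?_, h22⟩
  ext i j
  fin_cases i <;> fin_cases j <;> simp [adaptMatrix, *]

namespace FrenetSerret
variable {F T N B : ℝ → EuclideanSpace ℝ (Fin 3)} {σ κ τ : ℝ → ℝ}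
  {f : ℝ → ℙ ℝ HomCoord} {U : Set ℝ} {e : ℝ → Matrix (Fin 5) (Fin 5) ℝ}


/-- The change of frame from the Euclidean Darboux frame to a given frame. -/
def euclideanRel (F T N B : ℝ → EuclideanSpace ℝ (Fin 3)) (κ : ℝ → ℝ)
    (e : ℝ → Matrix (Fin 5) (Fin 5) ℝ) (t : ℝ) : Matrix (Fin 5) (Fin 5) ℝ :=
  lorentzMatrix * (euclideanDarboux (F t) (T t) (N t) (B t) (κ t))ᵀ * lorentzMatrix * e t

lemma euclideanRel_eq (h : FrenetSerret F T N B σ κ τ) (t : ℝ) :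
    euclideanRel F T N B κ e t = (euclideanDarboux (F t) (T t) (N t) (B t) (κ t))⁻¹ * e t := by
  rw [euclideanRel, lorentz_inv (h.darboux_mem t).1]

lemma darboux_mul_rel (h : FrenetSerret F T N B σ κ τ) (t : ℝ) :
    euclideanDarboux (F t) (T t) (N t) (B t) (κ t) * euclideanRel F T N B κ e t = e t := by
  rw [h.euclideanRel_eq,
    Matrix.mul_nonsing_inv_cancel_left _ _ (moebius_isUnit_det (h.darboux_mem t))]

lemma rel_lorentz (h : FrenetSerret F T N B σ κ τ) {t : ℝ} (he : e t ∈ moebiusGroup) :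
    (euclideanRel F T N B κ e t)ᵀ * lorentzMatrix * euclideanRel F T N B κ e t = lorentzMatrix ∧
      (euclideanRel F T N B κ e t).det = 1 := by
  have h1 := (h.darboux_mem t).1
  have h2 := he.1
  have h3 := he.2.1
  rw [← h.darboux_mul_rel (e := e) t] at h2 h3
  rw [Matrix.det_mul, (h.darboux_mem t).2.1, one_mul] at h3
  refine ⟨?_, h3⟩
  rw [Matrix.transpose_mul] at h2
  nth_rewrite 1 [← h1]
  simpa only [mul_assoc] using h2

lemma rel_deriv (h : FrenetSerret F T N B σ κ τ) (he : IsFrame f U e) (hU : IsOpen U) {t : ℝ}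
    (ht : t ∈ U) : HasMatDerivAt (euclideanRel F T N B κ e)
      (euclideanRel F T N B κ e t * mcForm e t -
        euclideanMC (σ t) (κ t) (deriv κ t) (τ t) * euclideanRel F T N B κ e t) t :=
  (h.darboux_deriv t).relative (he.hasMatDerivAt hU ht) (euclideanMC_skew _ _ _ _)

lemma rel_col_zero (h : FrenetSerret F T N B σ κ τ) (he : IsFrame f U e)
    (hf : ∀ t, f t = chi (F t)) {t : ℝ} (ht : t ∈ U) :
    euclideanRel F T N B κ e t 0 0 = e t 0 0 ∧ ∀ i, i ≠ 0 → euclideanRel F T N B κ e t i 0 = 0 := by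
  obtain ⟨_, hc⟩ := he.col_zero ht (hf t)
  have h1 : (fun i => e t i 0) =
      euclideanDarboux (F t) (T t) (N t) (B t) (κ t) *ᵥ Pi.single 0 (e t 0 0) := by
    ext i
    rw [hc, chiVec_eq]
    fin_cases i <;> simp [euclideanDarboux, mul_comm]
  have h2 : (fun i => euclideanRel F T N B κ e t i 0) = Pi.single 0 (e t 0 0) := by
    have h3 : (fun i => euclideanRel F T N B κ e t i 0) =
        (euclideanDarboux (F t) (T t) (N t) (B t) (κ t))⁻¹ *ᵥ fun i => e t i 0 := by
      ext i
      rw [h.euclideanRel_eq]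
      rfl
    rw [h3, h1, Matrix.mulVec_mulVec,
      Matrix.nonsing_inv_mul _ (moebius_isUnit_det (h.darboux_mem t)), Matrix.one_mulVec]
  exact ⟨by simpa using congrFun h2 0, fun i hi => by simpa [hi] using congrFun h2 i⟩

/-- Each identically vanishing entry of g, inserted into g' = gφ − ψg, gives an algebraic relation.
Column 0 of g is a multiple of the first basis vector; differentiating its zeros determines column 1
below the top entry, and differentiating g²₁ = g³₁ = 0 gives g²₄ = g³₄ = 0. The Lorentz relations
then leave only `adaptMatrix`. -/
lemma rel_eq_adaptMatrix (h : FrenetSerret F T N B σ κ τ) (he : IsDarbouxFrame f U e)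
    (hU : IsOpen U) (hf : ∀ t, f t = chi (F t)) {t : ℝ} (ht : t ∈ U) :
    mcForm e t 1 0 = σ t * e t 0 0 ∧
    euclideanRel F T N B κ e t = adaptMatrix (e t 0 0) (euclideanRel F T N B κ e t 0 1)
      (euclideanRel F T N B κ e t 2 2) (euclideanRel F T N B κ e t 3 2) ∧
    euclideanRel F T N B κ e t 2 2 ^ 2 + euclideanRel F T N B κ e t 3 2 ^ 2 = 1 := by
  have hfr := he.toIsFrame
  have hz : ∀ i j, (∀ u ∈ U, euclideanRel F T N B κ e u i j = 0) → ∀ u ∈ U,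
      (euclideanRel F T N B κ e u * mcForm e u -
        euclideanMC (σ u) (κ u) (deriv κ u) (τ u) * euclideanRel F T N B κ e u) i j = 0 := by
    intro i j hij u hu
    refine (h.rel_deriv hfr hU hu i j).unique
      ((hasDerivAt_const u (0 : ℝ)).congr_of_eventuallyEq ?_)
    filter_upwards [hU.mem_nhds hu] with v hv
    exact hij v hv
  have c0 : ∀ u ∈ U, euclideanRel F T N B κ e u 0 0 = e u 0 0 := fun u hu =>
    (h.rel_col_zero hfr hf hu).1
  have c1 : ∀ i, i ≠ 0 → ∀ u ∈ U, euclideanRel F T N B κ e u i 0 = 0 := fun i hi u hu =>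
    (h.rel_col_zero hfr hf hu).2 i hi
  -- Needed on all of `U`, not only at `t`, because these zeros are differentiated again. The
  -- Lorentz relation gives (g¹₁)² = 1, and the positivity of φ¹₀ selects the root 1.
  have col1 : ∀ u ∈ U, mcForm e u 1 0 = σ u * e u 0 0 ∧ euclideanRel F T N B κ e u 1 1 = 1 ∧
      euclideanRel F T N B κ e u 2 1 = 0 ∧ euclideanRel F T N B κ e u 3 1 = 0 ∧
      euclideanRel F T N B κ e u 4 1 = 0 := by
    intro u hu
    have z1 := hz 1 0 (c1 1 (by decide)) u hu
    have z2 := hz 2 0 (c1 2 (by decide)) u hu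
    have z3 := hz 3 0 (c1 3 (by decide)) u hu
    have z4 := hz 4 0 (c1 4 (by decide)) u hu
    have hp := he.phi10_pos u hu
    have hl := (hfr.col_zero hu (hf u)).1
    have g0 := c0 u hu
    have g1 := c1 1 (by decide) u hu
    have g2 := c1 2 (by decide) u hu
    have g3 := c1 3 (by decide) u hu
    have g4 := c1 4 (by decide) u hu
    have e11 := congrFun (congrFun (h.rel_lorentz (he.mem_moebius u hu)).1 1) 1
    have hσ := h.speed_pos u
    have p4 := (skew_entries (hfr.mcForm_skew hU hu)).1
    simp [Matrix.mul_apply, Matrix.vecMul, dotProduct, Fin.sum_univ_five, euclideanMC, g0, g1, g2,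
      g3, g4, p4,
      he.phi20 u hu, he.phi30 u hu, hp.ne'] at z1 z2 z3 z4
    simp [lorentzMatrix, Matrix.mul_apply, Fin.sum_univ_five, z2, z3, z4] at e11
    have hpos : 0 < euclideanRel F T N B κ e u 1 1 := by
      have : 0 < euclideanRel F T N B κ e u 1 1 * mcForm e u 1 0 := by
        have := mul_pos hσ hl
        linarith
      exact pos_of_mul_pos_left this hp.le
    have h11 : euclideanRel F T N B κ e u 1 1 = 1 := by nlinarith
    rw [h11] at z1
    exact ⟨by linarith, h11, z2, z3, z4⟩
  obtain ⟨hφ, g11, g21, g31, g41⟩ := col1 t ht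
  have hl := (hfr.col_zero ht (hf t)).1
  have z2 := hz 2 1 (fun u hu => (col1 u hu).2.2.1) t ht
  have z3 := hz 3 1 (fun u hu => (col1 u hu).2.2.2.1) t ht
  obtain ⟨p0, p1, p2, p3, p11, -⟩ := skew_entries (hfr.mcForm_skew hU ht)
  have g0 := c0 t ht
  have g1 := c1 1 (by decide) t ht
  have g2 := c1 2 (by decide) t ht
  have g3 := c1 3 (by decide) t ht
  have g4 := c1 4 (by decide) t ht
  have hp := he.phi10_pos t ht
  simp [Matrix.mul_apply, Matrix.vecMul, dotProduct, Fin.sum_univ_five, euclideanMC, g2, g3, g21, g31,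
    g41, p1, he.phi21 t ht,
    he.phi31 t ht, hp.ne'] at z2 z3
  obtain ⟨hL, hdet⟩ := h.rel_lorentz (he.mem_moebius t ht)
  exact ⟨hφ, eq_adaptMatrix hL hdet hl g0 g1 g2 g3 g4 g11 g21 g31 g41 z2 z3⟩

/-- The structure equations of a Darboux frame relative to the Euclidean Darboux frame. -/
lemma rel_structure (h : FrenetSerret F T N B σ κ τ) (he : IsDarbouxFrame f U e)
    (hU : IsOpen U) (hf : ∀ t, f t = chi (F t)) {t : ℝ} (ht : t ∈ U) {c s : ℝ}
    (hc : euclideanRel F T N B κ e t 2 2 = c) (hs : euclideanRel F T N B κ e t 3 2 = s) :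
    e t 0 0 * mcForm e t 0 2 = c * deriv κ t + s * (κ t * σ t * τ t) ∧
    e t 0 0 * mcForm e t 0 3 = -s * deriv κ t + c * (κ t * σ t * τ t) ∧
    HasDerivAt (fun u => euclideanRel F T N B κ e u 2 2) (-s * (mcForm e t 3 2 - σ t * τ t)) t ∧
    HasDerivAt (fun u => euclideanRel F T N B κ e u 3 2) (c * (mcForm e t 3 2 - σ t * τ t)) t ∧
    HasDerivAt (fun u => e u 0 0) (e t 0 0 * mcForm e t 0 0 +
      euclideanRel F T N B κ e t 0 1 * mcForm e t 1 0) t := by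
  have hfr := he.toIsFrame
  have hg : ∀ u ∈ U, _ := fun u hu => (h.rel_eq_adaptMatrix he hU hf hu).2.1
  have hd := h.rel_deriv hfr hU ht
  obtain ⟨p0, p1, p2, p3, p11, p22, p33, p12, p13, p23⟩ := skew_entries (hfr.mcForm_skew hU ht)
  have hz : ∀ i j, (∀ u ∈ U, euclideanRel F T N B κ e u i j = 0) →
      (euclideanRel F T N B κ e t * mcForm e t -
        euclideanMC (σ t) (κ t) (deriv κ t) (τ t) * euclideanRel F T N B κ e t) i j = 0 := by
    intro i j hij
    refine (hd i j).unique ((hasDerivAt_const t (0 : ℝ)).congr_of_eventuallyEq ?_)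
    filter_upwards [hU.mem_nhds ht] with v hv
    exact hij v hv
  -- The zeros g⁰₂ = g⁰₃ = 0 give the transformation law of (φ⁰₂, φ⁰₃).
  have z2 := hz 0 2 (fun u hu => by rw [hg u hu]; simp [adaptMatrix])
  have z3 := hz 0 3 (fun u hu => by rw [hg u hu]; simp [adaptMatrix])
  have d22 := hd 2 2
  have d32 := hd 3 2
  have d00 := hd 0 0
  have hgt := hg t ht
  rw [hc, hs] at hgt
  rw [hgt] at z2 z3 d22 d32 d00
  simp [Matrix.vecMul, dotProduct, Fin.sum_univ_five, euclideanMC, adaptMatrix,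
    p2, p3, p12, p13, he.phi20 t ht, he.phi30 t ht, he.phi21 t ht, he.phi31 t ht] at z2 z3
  refine ⟨by linarith, by linarith, d22.congr_deriv ?_, d32.congr_deriv ?_,
    (d00.congr_of_eventuallyEq ?_).congr_deriv ?_⟩
  · simp [Matrix.vecMul, dotProduct, Fin.sum_univ_five, euclideanMC, adaptMatrix,
      p22]
    ring
  · simp [Matrix.vecMul, dotProduct, Fin.sum_univ_five, euclideanMC, adaptMatrix,
      p22]
    ring
  · filter_upwards [hU.mem_nhds ht] with v hv
    exact ((h.rel_col_zero hfr hf hv).1).symm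
  · simp [Matrix.vecMul, dotProduct, Fin.sum_univ_five, euclideanMC, adaptMatrix,
      he.phi20 t ht, he.phi30 t ht, p0]

end FrenetSerret

/-! ### Changing the Darboux frame by an `adaptMatrix`. -/

lemma adaptMatrix_mem {l a c s : ℝ} (hl : 0 < l) (hcs : c ^ 2 + s ^ 2 = 1) :
    adaptMatrix l a c s ∈ moebiusGroup := by
  refine mem_moebiusGroup ?_ ?_ (by simpa [adaptMatrix] using hl)
  · have hl' := hl.ne'
    ext i j
    fin_cases i <;> fin_cases j <;>
      simp [lorentzMatrix, adaptMatrix, Matrix.mul_apply, Fin.sum_univ_five, hl'] <;> grind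
  · have hl' := hl.ne'
    simp [adaptMatrix, Matrix.det_succ_column_zero, Fin.sum_univ_succ, Fin.succAbove]
    field_simp
    linarith

/-- The derivatives in the last column stay unspecified: they affect only the last column of the new
Maurer-Cartan form, where no frame condition is imposed. -/
lemma adaptMatrix_deriv {l a c s : ℝ → ℝ} {l' a' c' s' t : ℝ} (hl : HasDerivAt l l' t)
    (ha : HasDerivAt a a' t) (hc : HasDerivAt c c' t) (hs : HasDerivAt s s' t) (h0 : l t ≠ 0) :
    ∃ d₀ d₁ d₄, HasMatDerivAt (fun u => adaptMatrix (l u) (a u) (c u) (s u))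
      !![l', a', 0, 0, d₀; 0, 0, 0, 0, d₁; 0, 0, c', -s', 0; 0, 0, s', c', 0; 0, 0, 0, 0, d₄] t := by
  have h0' : 2 * l t ≠ 0 := mul_ne_zero two_ne_zero h0
  have h04 := (ha.pow 2).div (hl.const_mul 2) h0'
  have h14 := ha.div hl h0
  have h44 := hl.inv h0
  have z := hasDerivAt_const t (0 : ℝ)
  have o := hasDerivAt_const t (1 : ℝ)
  obtain ⟨d₀, h04⟩ : ∃ d, HasDerivAt (fun u => a u ^ 2 / (2 * l u)) d t := ⟨_, h04⟩
  obtain ⟨d₁, h14⟩ : ∃ d, HasDerivAt (fun u => a u / l u) d t := ⟨_, h14⟩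
  obtain ⟨d₄, h44⟩ : ∃ d, HasDerivAt (fun u => (l u)⁻¹) d t := ⟨_, h44⟩
  refine ⟨d₀, d₁, d₄, fun i j => ?_⟩
  fin_cases i <;> fin_cases j
  exacts [hl, ha, z, z, h04, z, o, z, z, h14, z, z, hc, hs.neg, z, z, z, hs, hc, z, z, z, z, z, h44]

/-- The entries of the Maurer-Cartan form after a change of Darboux frame. -/
lemma adapt_mc_entries {l a c s l' a' c' s' d₀ d₁ d₄ σ κ κ' τ : ℝ} (hl : l ≠ 0)
    {φ : Matrix (Fin 5) (Fin 5) ℝ}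
    (hφ : φ = lorentzMatrix * (adaptMatrix l a c s)ᵀ * lorentzMatrix *
      (euclideanMC σ κ κ' τ * adaptMatrix l a c s +
      !![l', a', 0, 0, d₀; 0, 0, 0, 0, d₁; 0, 0, c', -s', 0; 0, 0, s', c', 0; 0, 0, 0, 0, d₄])) :
    φ 0 0 = l⁻¹ * l' - a * σ ∧ φ 1 0 = σ * l ∧ φ 2 0 = 0 ∧ φ 3 0 = 0 ∧ φ 2 1 = 0 ∧ φ 3 1 = 0 ∧
      φ 0 2 = l⁻¹ * (c * κ' + s * (κ * σ * τ)) ∧ φ 0 3 = l⁻¹ * (-s * κ' + c * (κ * σ * τ)) := by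
  rw [hφ]
  refine ⟨?_, ?_, ?_, ?_, ?_, ?_, ?_, ?_⟩ <;>
    simp [lorentzMatrix, adaptMatrix, euclideanMC, Matrix.mul_apply, Matrix.vecMul, dotProduct,
      Fin.sum_univ_five]
  · field_simp
    ring
  · exact Or.inl (by ring)
  · exact Or.inl (by ring)

/-! ### Recovering the curve `F` from `χ ∘ F`. -/

lemma chi_injective : Function.Injective chi := by
  intro x y h
  rw [chi, chi, Projectivization.mk_eq_mk_iff'] at h
  obtain ⟨a, ha⟩ := h
  have h0 := congrFun ha 0
  have h1 := congrFun ha 1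
  have h2 := congrFun ha 2
  have h3 := congrFun ha 3
  simp [chiVec] at h0 h1 h2 h3
  ext i
  fin_cases i <;> simp [*] <;> simp_all

/-- A curve in `ℝ³` is smooth if its image under `χ` has smooth local frames. -/
lemma contDiff_of_frames {f : ℝ → ℙ ℝ HomCoord} {F : ℝ → EuclideanSpace ℝ (Fin 3)}
    (hF : ∀ t, f t = chi (F t))
    (h : ∀ q, ∃ U : Set ℝ, IsOpen U ∧ q ∈ U ∧ ∃ e, IsFrame f U e) : ContDiff ℝ ∞ F := by
  rw [contDiff_euclidean]
  intro i
  rw [contDiff_iff_contDiffAt]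
  intro q
  obtain ⟨U, hU, hq, e, he⟩ := h q
  have hs := fun j => (he.smooth j 0).contDiffAt (hU.mem_nhds hq)
  refine ((hs i.succ.castSucc).div (hs 0) (he.col_zero hq (hF q)).1.ne').congr_of_eventuallyEq ?_
  filter_upwards [hU.mem_nhds hq] with u hu
  obtain ⟨h1, h2⟩ := he.col_zero hu (hF u)
  have h3 : F u i = e u i.succ.castSucc 0 / e u 0 0 := by
    rw [h2 i.succ.castSucc, mul_div_cancel_left₀ _ h1.ne']
    fin_cases i <;> simp [chiVec]
  exact h3

/-! ### Winding of periodic rotations -/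

/-- No angle function is lifted: z = c + is satisfies z' = iwz, so z·exp(−iW) is constant, where W
is the primitive of w. As z(L) = z(0) ≠ 0, it follows that exp(−iW(L)) = 1. -/
lemma winding_integral {c s w : ℝ → ℝ} {L : ℝ} (hw : Continuous w)
    (hc : ∀ t, HasDerivAt c (-s t * w t) t) (hs : ∀ t, HasDerivAt s (c t * w t) t)
    (hcs : ∀ t, c t ^ 2 + s t ^ 2 = 1) (hcL : c L = c 0) (hsL : s L = s 0) :
    ∃ n : ℤ, ∫ t in (0 : ℝ)..L, w t = n * (2 * Real.pi) := by
  set W : ℝ → ℝ := fun t => ∫ u in (0 : ℝ)..t, w u with hW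
  have hWd : ∀ t, HasDerivAt W (w t) t := fun t =>
    intervalIntegral.integral_hasDerivAt_right (hw.intervalIntegrable _ _)
      (hw.stronglyMeasurableAtFilter _ _) hw.continuousAt
  set z : ℝ → ℂ := fun t => c t + s t * Complex.I with hz
  have hzd : ∀ t, HasDerivAt z (Complex.I * w t * z t) t := by
    intro t
    refine ((hc t).ofReal_comp.add ((hs t).ofReal_comp.mul_const Complex.I)).congr_deriv ?_
    simp only [hz]
    push_cast
    linear_combination (-(s t : ℂ) * w t) * Complex.I_sq
  have hED : ∀ t, HasDerivAt (fun u => z u * Complex.exp (-(Complex.I * W u))) 0 t := by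
    intro t
    refine ((hzd t).mul (((hWd t).ofReal_comp.const_mul Complex.I).neg.cexp)).congr_deriv ?_
    ring
  have hconst := is_const_of_deriv_eq_zero (fun t => (hED t).differentiableAt)
    (fun t => (hED t).deriv) L 0
  have hz0 : z 0 ≠ 0 := by
    intro h
    have h1 := congrArg Complex.re h
    have h2 := congrArg Complex.im h
    simp [hz] at h1 h2
    have := hcs 0
    rw [h1, h2] at this
    norm_num at this
  have hzL : z L = z 0 := by simp only [hz, hcL, hsL]
  have hW0 : W 0 = 0 := by simp [hW]
  rw [hzL, hW0] at hconst
  have h1 := mul_left_cancel₀ hz0 hconst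
  rw [Complex.ofReal_zero, mul_zero, neg_zero, Complex.exp_zero, Complex.exp_eq_one_iff] at h1
  obtain ⟨n, hn⟩ := h1
  -- The sign arises because the exponent is −iW(L) = 2πin.
  refine ⟨-n, ?_⟩
  have h2 : (W L : ℂ) = ((-n : ℤ) * (2 * Real.pi) : ℝ) := by
    have hI := Complex.I_ne_zero
    apply mul_left_cancel₀ hI
    push_cast
    linear_combination -hn
  exact_mod_cast h2

/-! ### The Frenet frame -/

/-- The scale `λ` of the Frenet frame `e` along `χ ∘ F`, for which `e_0 = λ (1, F, |F|²/2)`. -/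
def frenetScale (σ κ τ : ℝ → ℝ) (t : ℝ) : ℝ :=
  √(√(deriv κ t ^ 2 + (κ t * σ t * τ t) ^ 2) / σ t)

/-- The cosine of the angle between the Euclidean and the conformal normal frames. -/
def frenetCos (σ κ τ : ℝ → ℝ) (t : ℝ) : ℝ := deriv κ t / (frenetScale σ κ τ t ^ 2 * σ t)

/-- The sine of the angle between the Euclidean and the conformal normal frames. -/
def frenetSin (σ κ τ : ℝ → ℝ) (t : ℝ) : ℝ :=
  κ t * σ t * τ t / (frenetScale σ κ τ t ^ 2 * σ t)

/-- The shift of the first vector of the Frenet frame. -/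
def frenetShift (σ κ τ : ℝ → ℝ) (t : ℝ) : ℝ :=
  deriv (frenetScale σ κ τ) t / (frenetScale σ κ τ t * σ t)

/-- The Frenet frame of `χ ∘ F` in terms of the Euclidean Frenet data of `F`. -/
def frenetFrame (F T N B : ℝ → EuclideanSpace ℝ (Fin 3)) (σ κ τ : ℝ → ℝ) (t : ℝ) :
    Matrix (Fin 5) (Fin 5) ℝ :=
  euclideanDarboux (F t) (T t) (N t) (B t) (κ t) *
    adaptMatrix (frenetScale σ κ τ t) (frenetShift σ κ τ t) (frenetCos σ κ τ t) (frenetSin σ κ τ t)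

namespace FrenetSerret
variable {F T N B : ℝ → EuclideanSpace ℝ (Fin 3)} {σ κ τ : ℝ → ℝ}
  {f : ℝ → ℙ ℝ HomCoord} {e : ℝ → Matrix (Fin 5) (Fin 5) ℝ}

/-- Up to positive factors, (p², p³) is a rotation of (κ', κστ), so the two vectors vanish together.
-/
lemma regular_of_generic (h : FrenetSerret F T N B σ κ τ) (hf : ∀ t, f t = chi (F t)) {q : ℝ}
    (hg : IsOneGenericAt f q) : deriv κ q ^ 2 + (κ q * σ q * τ q) ^ 2 ≠ 0 := by
  obtain ⟨U, hU, hq, e, he, hp⟩ := hg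
  intro h0
  have h1 : deriv κ q = 0 := by nlinarith [sq_nonneg (deriv κ q), sq_nonneg (κ q * σ q * τ q)]
  have h2 : κ q * σ q * τ q = 0 := by
    nlinarith [sq_nonneg (deriv κ q), sq_nonneg (κ q * σ q * τ q)]
  obtain ⟨h3, h4, -⟩ := h.rel_structure he hU hf hq rfl rfl
  have hl := (he.col_zero hq (hf q)).1.ne'
  rw [h1, h2] at h3 h4
  simp [hl] at h3 h4
  exact hp (by simp [darbouxCoeff, h3, h4])

lemma frenetScale_pos (h : FrenetSerret F T N B σ κ τ) {t : ℝ}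
    (hr : deriv κ t ^ 2 + (κ t * σ t * τ t) ^ 2 ≠ 0) : 0 < frenetScale σ κ τ t := by
  have h1 : 0 < deriv κ t ^ 2 + (κ t * σ t * τ t) ^ 2 := lt_of_le_of_ne (by positivity) hr.symm
  exact Real.sqrt_pos.mpr (div_pos (Real.sqrt_pos.mpr h1) (h.speed_pos t))

lemma frenetScale_sq (h : FrenetSerret F T N B σ κ τ) (t : ℝ) :
    frenetScale σ κ τ t ^ 2 * σ t = √(deriv κ t ^ 2 + (κ t * σ t * τ t) ^ 2) := by
  have hσ := h.speed_pos t
  rw [frenetScale, Real.sq_sqrt (by positivity), div_mul_cancel₀ _ hσ.ne']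

lemma frenetCos_sq_add (h : FrenetSerret F T N B σ κ τ) {t : ℝ}
    (hr : deriv κ t ^ 2 + (κ t * σ t * τ t) ^ 2 ≠ 0) :
    frenetCos σ κ τ t ^ 2 + frenetSin σ κ τ t ^ 2 = 1 := by
  rw [frenetCos, frenetSin, h.frenetScale_sq, div_pow, div_pow, Real.sq_sqrt (by positivity),
    ← add_div, div_self hr]

lemma smooth_deriv_curvature (h : FrenetSerret F T N B σ κ τ) : ContDiff ℝ ∞ (deriv κ) :=
  (contDiff_infty_iff_deriv.mp h.smooth_curvature).2

lemma frenetScale_smooth (h : FrenetSerret F T N B σ κ τ)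
    (hr : ∀ t, deriv κ t ^ 2 + (κ t * σ t * τ t) ^ 2 ≠ 0) : ContDiff ℝ ∞ (frenetScale σ κ τ) := by
  have h1 := h.smooth_deriv_curvature
  have h2 := h.smooth_curvature
  have h3 := h.smooth_speed
  have h4 := h.smooth_torsion
  have hq : ContDiff ℝ ∞ fun t => deriv κ t ^ 2 + (κ t * σ t * τ t) ^ 2 := by fun_prop
  exact ((hq.sqrt hr).div h3 fun t => (h.speed_pos t).ne').sqrt fun t =>
    (Real.sqrt_pos.mp (h.frenetScale_pos (hr t))).ne'

lemma frenetScale_sq_mul_ne (h : FrenetSerret F T N B σ κ τ) {t : ℝ}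
    (hr : deriv κ t ^ 2 + (κ t * σ t * τ t) ^ 2 ≠ 0) : frenetScale σ κ τ t ^ 2 * σ t ≠ 0 :=
  mul_ne_zero (pow_ne_zero _ (h.frenetScale_pos hr).ne') (h.speed_pos t).ne'

lemma frenetCos_smooth (h : FrenetSerret F T N B σ κ τ)
    (hr : ∀ t, deriv κ t ^ 2 + (κ t * σ t * τ t) ^ 2 ≠ 0) : ContDiff ℝ ∞ (frenetCos σ κ τ) :=
  h.smooth_deriv_curvature.div (((h.frenetScale_smooth hr).pow 2).mul h.smooth_speed) fun t =>
    h.frenetScale_sq_mul_ne (hr t)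

lemma frenetSin_smooth (h : FrenetSerret F T N B σ κ τ)
    (hr : ∀ t, deriv κ t ^ 2 + (κ t * σ t * τ t) ^ 2 ≠ 0) : ContDiff ℝ ∞ (frenetSin σ κ τ) :=
  ((h.smooth_curvature.mul h.smooth_speed).mul h.smooth_torsion).div
    (((h.frenetScale_smooth hr).pow 2).mul h.smooth_speed) fun t => h.frenetScale_sq_mul_ne (hr t)

lemma frenetShift_smooth (h : FrenetSerret F T N B σ κ τ)
    (hr : ∀ t, deriv κ t ^ 2 + (κ t * σ t * τ t) ^ 2 ≠ 0) : ContDiff ℝ ∞ (frenetShift σ κ τ) :=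
  ((contDiff_infty_iff_deriv.mp (h.frenetScale_smooth hr)).2).div
    ((h.frenetScale_smooth hr).mul h.smooth_speed) fun t =>
      mul_ne_zero (h.frenetScale_pos (hr t)).ne' (h.speed_pos t).ne'

lemma frenetFrame_smooth (h : FrenetSerret F T N B σ κ τ)
    (hr : ∀ t, deriv κ t ^ 2 + (κ t * σ t * τ t) ^ 2 ≠ 0) (i j : Fin 5) :
    ContDiff ℝ ∞ fun t => frenetFrame F T N B σ κ τ t i j := by
  have hl := h.frenetScale_smooth hr
  have ha := h.frenetShift_smooth hr
  have hc := h.frenetCos_smooth hr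
  have hs := h.frenetSin_smooth hr
  have h0 : ∀ t, frenetScale σ κ τ t ≠ 0 := fun t => (h.frenetScale_pos (hr t)).ne'
  have hM : ∀ i j, ContDiff ℝ ∞ fun t => adaptMatrix (frenetScale σ κ τ t) (frenetShift σ κ τ t)
      (frenetCos σ κ τ t) (frenetSin σ κ τ t) i j := by
    have z : ContDiff ℝ ∞ fun _ : ℝ => (0 : ℝ) := contDiff_const
    have o : ContDiff ℝ ∞ fun _ : ℝ => (1 : ℝ) := contDiff_const
    have h04 := (ha.pow 2).div (contDiff_const.mul hl) fun t => mul_ne_zero two_ne_zero (h0 t)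
    intro i j
    fin_cases i <;> fin_cases j
    exacts [hl, ha, z, z, h04, z, o, z, z, ha.div hl h0, z, z, hc, hs.neg, z, z, z, hs, hc, z, z, z,
      z, z, hl.inv h0]
  simp only [frenetFrame, Matrix.mul_apply]
  exact ContDiff.sum fun k _ => (h.darboux_smooth i k).mul (hM k j)

/-- Here (κ', κστ) = l²σ(c, s), so rotating by −θ leaves (l²σ, 0): this gives φ⁰₂ = σl = φ¹₀ and φ⁰₃
= 0. The shift is chosen so that φ⁰₀ = l'/l − aσ vanishes. -/
theorem frenetFrame_isFrenetFrame (h : FrenetSerret F T N B σ κ τ) (hf : ∀ t, f t = chi (F t))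
    (hr : ∀ t, deriv κ t ^ 2 + (κ t * σ t * τ t) ^ 2 ≠ 0) :
    IsFrenetFrame f Set.univ (frenetFrame F T N B σ κ τ) := by
  have hmem : ∀ t, frenetFrame F T N B σ κ τ t ∈ moebiusGroup := fun t =>
    moebius_mul (h.darboux_mem t)
      (adaptMatrix_mem (h.frenetScale_pos (hr t)) (h.frenetCos_sq_add (hr t)))
  have hcol : ∀ t i, frenetFrame F T N B σ κ τ t i 0 = frenetScale σ κ τ t * chiVec (F t) i := by
    intro t i
    rw [chiVec_eq, frenetFrame]
    fin_cases i <;>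
      simp [Matrix.mul_apply, Fin.sum_univ_five, euclideanDarboux, adaptMatrix, mul_comm]
  have key : ∀ t, mcForm (frenetFrame F T N B σ κ τ) t 0 0 = 0 ∧
      mcForm (frenetFrame F T N B σ κ τ) t 1 0 = σ t * frenetScale σ κ τ t ∧
      mcForm (frenetFrame F T N B σ κ τ) t 2 0 = 0 ∧
      mcForm (frenetFrame F T N B σ κ τ) t 3 0 = 0 ∧
      mcForm (frenetFrame F T N B σ κ τ) t 2 1 = 0 ∧
      mcForm (frenetFrame F T N B σ κ τ) t 3 1 = 0 ∧
      mcForm (frenetFrame F T N B σ κ τ) t 0 2 = σ t * frenetScale σ κ τ t ∧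
      mcForm (frenetFrame F T N B σ κ τ) t 0 3 = 0 := by
    intro t
    have d : ∀ {g : ℝ → ℝ}, ContDiff ℝ ∞ g → HasDerivAt g (deriv g t) t := fun hg =>
      ((hg.differentiable (by simp)) t).hasDerivAt
    have hl := h.frenetScale_pos (hr t)
    have hσ := h.speed_pos t
    have hadm := (adaptMatrix_mem (a := frenetShift σ κ τ t) hl (h.frenetCos_sq_add (hr t))).1
    obtain ⟨d₀, d₁, d₄, hM⟩ := adaptMatrix_deriv (d (h.frenetScale_smooth hr))
      (d (h.frenetShift_smooth hr)) (d (h.frenetCos_smooth hr)) (d (h.frenetSin_smooth hr)) hl.ne'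
    have hφ := ((h.darboux_deriv t).mul hM).mcForm_eq
    rw [mul_assoc, ← mul_add, Matrix.mul_inv_rev, lorentz_inv hadm, mul_assoc,
      Matrix.nonsing_inv_mul_cancel_left _ _ (moebius_isUnit_det (h.darboux_mem t))] at hφ
    obtain ⟨q00, q10, q20, q30, q21, q31, q02, q03⟩ := adapt_mc_entries hl.ne' hφ
    have hK := h.frenetScale_sq_mul_ne (hr t)
    have hA : deriv κ t = frenetCos σ κ τ t * (frenetScale σ κ τ t ^ 2 * σ t) := by
      rw [frenetCos, div_mul_cancel₀ _ hK]
    have hB : κ t * σ t * τ t = frenetSin σ κ τ t * (frenetScale σ κ τ t ^ 2 * σ t) := by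
      rw [frenetSin, div_mul_cancel₀ _ hK]
    have hcs := h.frenetCos_sq_add (hr t)
    refine ⟨q00.trans ?_, q10, q20, q30, q21, q31, q02.trans ?_, q03.trans ?_⟩
    · rw [frenetShift]
      field_simp
      ring
    · rw [hA, hB]
      field_simp
      linear_combination hcs
    · rw [hA, hB]
      ring
  exact
    { smooth := fun i j => (h.frenetFrame_smooth hr i j).contDiffOn
      mem_moebius := fun t _ => hmem t
      proj := fun t _ => by
        have hne : (fun i => frenetFrame F T N B σ κ τ t i 0) ≠ 0 := by
          intro h0
          have := congrFun h0 0
          simp only [hcol] at this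
          simp [chiVec, (h.frenetScale_pos (hr t)).ne'] at this
        refine ⟨hne, ?_⟩
        rw [hf, chi, Projectivization.mk_eq_mk_iff']
        exact ⟨frenetScale σ κ τ t, by ext i; simp [hcol]⟩
      phi20 := fun t _ => (key t).2.2.1
      phi30 := fun t _ => (key t).2.2.2.1
      phi10_pos := fun t _ => by
        rw [(key t).2.1]; exact mul_pos (h.speed_pos t) (h.frenetScale_pos (hr t))
      phi21 := fun t _ => (key t).2.2.2.2.1
      phi31 := fun t _ => (key t).2.2.2.2.2.1
      phi02 := fun t _ => by rw [(key t).2.2.2.2.2.2.1, (key t).2.1]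
      phi03 := fun t _ => (key t).2.2.2.2.2.2.2
      phi00 := fun t _ => (key t).1 }

/-- The relative position of a Frenet frame with respect to the Euclidean Darboux frame. -/
lemma frenet_rel (h : FrenetSerret F T N B σ κ τ) (hf : ∀ t, f t = chi (F t))
    (he : IsFrenetFrame f Set.univ e) (t : ℝ) :
    deriv κ t ^ 2 + (κ t * σ t * τ t) ^ 2 ≠ 0 ∧ e t 0 0 = frenetScale σ κ τ t ∧
      euclideanRel F T N B κ e t 2 2 = frenetCos σ κ τ t ∧
      euclideanRel F T N B κ e t 3 2 = frenetSin σ κ τ t := by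
  have hD := he.toIsDarbouxFrame
  have ht := Set.mem_univ t
  obtain ⟨h10, -, hcs⟩ := h.rel_eq_adaptMatrix hD isOpen_univ hf ht
  obtain ⟨h02, h03, -⟩ := h.rel_structure hD isOpen_univ hf ht rfl rfl
  have hl := (hD.col_zero ht (hf t)).1
  have hσ := h.speed_pos t
  rw [he.phi02 t ht, h10] at h02
  rw [he.phi03 t ht, mul_zero] at h03
  set l := e t 0 0
  set c := euclideanRel F T N B κ e t 2 2
  set s := euclideanRel F T N B κ e t 3 2
  -- `h02` and `h03` say that (κ', κστ) rotated by −θ is (l²σ, 0). This equation and `hB` undo the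
  -- rotation.
  have hA : deriv κ t = c * (l ^ 2 * σ t) := by
    linear_combination (-deriv κ t) * hcs - c * h02 + s * h03
  have hB : κ t * σ t * τ t = s * (l ^ 2 * σ t) := by
    linear_combination (-(κ t * σ t * τ t)) * hcs - s * h02 - c * h03
  have hsum : deriv κ t ^ 2 + (κ t * σ t * τ t) ^ 2 = (l ^ 2 * σ t) ^ 2 := by
    rw [hA, hB]
    linear_combination (l ^ 2 * σ t) ^ 2 * hcs
  have hpos : 0 < l ^ 2 * σ t := by positivity
  have hscale : l = frenetScale σ κ τ t := by
    rw [frenetScale, hsum, Real.sqrt_sq hpos.le, mul_div_cancel_right₀ _ hσ.ne',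
      Real.sqrt_sq hl.le]
  refine ⟨by rw [hsum]; positivity, hscale, ?_, ?_⟩
  · rw [frenetCos, ← hscale, hA, mul_div_cancel_right₀ _ hpos.ne']
  · rw [frenetSin, ← hscale, hB, mul_div_cancel_right₀ _ hpos.ne']

/-- `frenet_rel` fixes the scale and the rotation. Because the scale is known at every parameter,
its derivative is known too, and l' = aφ¹₀, valid when φ⁰₀ = 0, fixes the shift. -/
theorem eq_frenetFrame (h : FrenetSerret F T N B σ κ τ) (hf : ∀ t, f t = chi (F t))
    (he : IsFrenetFrame f Set.univ e) : e = frenetFrame F T N B σ κ τ := by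
  funext t
  have hD := he.toIsDarbouxFrame
  have ht := Set.mem_univ t
  obtain ⟨hr, h00, hc, hs⟩ := h.frenet_rel hf he t
  obtain ⟨h10, hM, -⟩ := h.rel_eq_adaptMatrix hD isOpen_univ hf ht
  obtain ⟨-, -, -, -, hd⟩ := h.rel_structure hD isOpen_univ hf ht rfl rfl
  have hfun : (fun u => e u 0 0) = frenetScale σ κ τ :=
    funext fun u => (h.frenet_rel hf he u).2.1
  have hl := h.frenetScale_pos hr
  have hσ := h.speed_pos t
  rw [hfun, he.phi00 t ht, h10, h00, mul_zero, zero_add] at hd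
  have ha : euclideanRel F T N B κ e t 0 1 = frenetShift σ κ τ t := by
    rw [frenetShift, hd.deriv]
    field_simp
  rw [← h.darboux_mul_rel (e := e) t, hM, frenetFrame, h00, hc, hs, ha]

end FrenetSerret

/-! ### Periodicity, comparison of total twists, and conformal invariance. -/

lemma deriv_periodic {E : Type*} [NormedAddCommGroup E] [NormedSpace ℝ E] {g : ℝ → E} {L : ℝ}
    (hg : Function.Periodic g L) : Function.Periodic (deriv g) L := by
  intro t
  have h1 : (fun u => g (u + L)) = g := funext hg
  rw [← deriv_comp_add_const, h1]

lemma arcDeriv_periodic {F X : ℝ → EuclideanSpace ℝ (Fin 3)} {L : ℝ}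
    (hF : Function.Periodic F L) (hX : Function.Periodic X L) :
    Function.Periodic (arcDeriv F X) L := fun t => by
  rw [arcDeriv, arcDeriv, deriv_periodic hF t, deriv_periodic hX t]

/-- The integral of the conformal torsion form and the Euclidean total torsion agree modulo `2π`. -/
theorem frenet_totalTwist {f : ℝ → ℙ ℝ HomCoord} {L : ℝ} (hL : Function.Periodic f L)
    {F : ℝ → EuclideanSpace ℝ (Fin 3)} (hf : ∀ t, f t = chi (F t))
    (hk : ∀ t, curvature F t ≠ 0) {e : ℝ → Matrix (Fin 5) (Fin 5) ℝ}
    (he : IsFrenetFrame f Set.univ e) :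
    (((2 * Real.pi)⁻¹ * ∫ t in (0 : ℝ)..L, mu2 e t * conformalSpeed e t : ℝ) : UnitAddCircle) =
      totalTwist F L := by
  have hFs : ContDiff ℝ ∞ F := contDiff_of_frames hf fun q =>
    ⟨Set.univ, isOpen_univ, Set.mem_univ q, e, he.toIsFrame⟩
  have h := frenetSerret hFs hk
  have hFL : Function.Periodic F L := fun t => chi_injective (by rw [← hf, ← hf, hL t])
  have hTL : Function.Periodic (unitTangent F) L := arcDeriv_periodic hFL hFL
  have hκL : Function.Periodic (curvature F) L := fun t => by
    rw [curvature, curvature, arcDeriv_periodic hFL hTL t]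
  have hNL : Function.Periodic (principalNormal F) L := fun t => by
    rw [principalNormal, principalNormal, hκL t, arcDeriv_periodic hFL hTL t]
  have hτL : Function.Periodic (torsion F) L := fun t => by
    rw [torsion, torsion, arcDeriv_periodic hFL hNL t, binormal, binormal, hTL t, hNL t]
  have hσL : Function.Periodic (fun t => ‖deriv F t‖) L := fun t => by
    simp only [deriv_periodic hFL t]
  have hr := fun t => (h.frenet_rel hf he t).1
  set σ : ℝ → ℝ := fun t => ‖deriv F t‖ with hσ
  set c := frenetCos σ (curvature F) (torsion F) with hc
  set s := frenetSin σ (curvature F) (torsion F) with hs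
  have hlL : frenetScale σ (curvature F) (torsion F) L =
      frenetScale σ (curvature F) (torsion F) 0 := by
    simp only [frenetScale, hκL.eq, hσL.eq, hτL.eq, (deriv_periodic hκL).eq]
  have hcL : c L = c 0 := by
    simp only [hc, frenetCos, hlL, hσL.eq, (deriv_periodic hκL).eq]
  have hsL : s L = s 0 := by
    simp only [hs, frenetSin, hlL, hκL.eq, hσL.eq, hτL.eq]
  -- w is θ', the rate at which the conformal normal frame turns relative to the Euclidean one.
  set w : ℝ → ℝ := fun t => mcForm e t 3 2 - σ t * torsion F t with hw
  have hcs : ∀ t, c t ^ 2 + s t ^ 2 = 1 := fun t => h.frenetCos_sq_add (hr t)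
  have hD := he.toIsDarbouxFrame
  have hst := fun t => h.rel_structure hD isOpen_univ hf (Set.mem_univ t)
    (h.frenet_rel hf he t).2.2.1 (h.frenet_rel hf he t).2.2.2
  have hcd : ∀ t, HasDerivAt c (-s t * w t) t := by
    intro t
    have h1 := (hst t).2.2.1
    rwa [show (fun u => FrenetSerret.euclideanRel F _ _ _ (curvature F) e u 2 2) = c from
      funext fun u => (h.frenet_rel hf he u).2.2.1] at h1
  have hsd : ∀ t, HasDerivAt s (c t * w t) t := by
    intro t
    have h1 := (hst t).2.2.2.1
    rwa [show (fun u => FrenetSerret.euclideanRel F _ _ _ (curvature F) e u 3 2) = s from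
      funext fun u => (h.frenet_rel hf he u).2.2.2] at h1
  -- Writing w = cs' − sc' reduces continuity to the smoothness of c and s, so no regularity of
  -- `mcForm` is needed.
  have hwc : Continuous w := by
    have h1 : w = fun t => c t * deriv s t - s t * deriv c t := by
      funext t
      rw [(hcd t).deriv, (hsd t).deriv]
      linear_combination (-w t) * hcs t
    have h2 := h.frenetCos_smooth hr
    have h3 := h.frenetSin_smooth hr
    have h4 := (contDiff_infty_iff_deriv.mp h2).2
    have h5 := (contDiff_infty_iff_deriv.mp h3).2
    rw [h1]
    exact (h2.continuous.mul h5.continuous).sub (h3.continuous.mul h4.continuous)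
  obtain ⟨n, hn⟩ := winding_integral hwc hcd hsd hcs hcL hsL
  have hint : ∫ t in (0 : ℝ)..L, mu2 e t * conformalSpeed e t =
      (∫ t in (0 : ℝ)..L, torsion F t * ‖deriv F t‖) + n * (2 * Real.pi) := by
    rw [← hn, ← intervalIntegral.integral_add]
    · refine intervalIntegral.integral_congr fun t _ => ?_
      have := (he.phi10_pos t (Set.mem_univ t)).ne'
      simp only [mu2, conformalSpeed, hw, hσ]
      rw [div_mul_cancel₀ _ this]
      ring
    · exact (h.smooth_torsion.continuous.mul h.smooth_speed.continuous).intervalIntegrable _ _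
    · exact hwc.intervalIntegrable _ _
  have hpi := Real.pi_pos.ne'
  rw [totalTwist, hint, mul_add, AddCircle.coe_add, add_eq_left, AddCircle.coe_eq_zero_iff]
  refine ⟨n, ?_⟩
  simp only [zsmul_eq_mul, mul_one]
  field_simp

/-- The Möbius group maps Frenet frames to Frenet frames without changing the Maurer-Cartan form. -/
lemma moebiusAct_frenet {f : ℝ → ℙ ℝ HomCoord} {e : ℝ → Matrix (Fin 5) (Fin 5) ℝ}
    (he : IsFrenetFrame f Set.univ e) (G : moebiusGroup) :
    mcForm (fun t => G * e t) = mcForm e ∧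
      IsFrenetFrame (fun t => moebiusAct G (f t)) Set.univ (fun t => G * e t) := by
  have hmc : mcForm (fun t => (G : Matrix (Fin 5) (Fin 5) ℝ) * e t) = mcForm e := by
    funext t
    have h1 := (HasMatDerivAt.const (G : Matrix (Fin 5) (Fin 5) ℝ) t).mul
      (he.hasMatDerivAt isOpen_univ (Set.mem_univ t))
    rw [zero_mul, zero_add, ← mul_assoc] at h1
    exact h1.mcForm_eq_of_mul
      (moebius_isUnit_det (moebius_mul G.2 (he.mem_moebius t (Set.mem_univ t))))
  have hcol : ∀ t, (fun i => ((G : Matrix (Fin 5) (Fin 5) ℝ) * e t) i 0) =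
      Matrix.toLin' (G : Matrix (Fin 5) (Fin 5) ℝ) fun i => e t i 0 := by
    intro t
    ext i
    simp [Matrix.mul_apply, Matrix.mulVec, dotProduct]
  refine ⟨hmc, ?_⟩
  exact
    { smooth := fun i j => by
        simp only [Matrix.mul_apply]
        exact ContDiffOn.sum fun k _ => contDiffOn_const.mul (he.smooth k j)
      mem_moebius := fun t ht => moebius_mul G.2 (he.mem_moebius t ht)
      proj := fun t ht => by
        obtain ⟨h0, h1⟩ := he.proj t ht
        simp only [hcol, ← h1]
        refine ⟨fun h2 => h0 (moebius_injective G (by rw [h2, map_zero])), ?_⟩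
        rw [moebiusAct, Projectivization.map_mk]
      phi20 := by rw [hmc]; exact he.phi20
      phi30 := by rw [hmc]; exact he.phi30
      phi10_pos := by rw [hmc]; exact he.phi10_pos
      phi21 := by rw [hmc]; exact he.phi21
      phi31 := by rw [hmc]; exact he.phi31
      phi02 := by rw [hmc]; exact he.phi02
      phi03 := by rw [hmc]; exact he.phi03
      phi00 := by rw [hmc]; exact he.phi00 }

end

theorem mainTheorem8 (f : ℝ → ℙ ℝ HomCoord) (L : ℝ) (hf : IsClosedCurve f L)
    (hgen : IsOneGeneric f)
    (F : ℝ → EuclideanSpace ℝ (Fin 3)) (hF : ∀ t, f t = chi (F t))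
    (hk : ∀ t, curvature F t ≠ 0) :
    (∃! e : ℝ → Matrix (Fin 5) (Fin 5) ℝ, IsFrenetFrame f Set.univ e) ∧
    (∀ e : ℝ → Matrix (Fin 5) (Fin 5) ℝ, IsFrenetFrame f Set.univ e →
      (((2 * Real.pi)⁻¹ * ∫ t in (0 : ℝ)..L, mu2 e t * conformalSpeed e t : ℝ) : UnitAddCircle) =
        totalTwist F L) ∧
    (∀ (G : moebiusGroup) (F' : ℝ → EuclideanSpace ℝ (Fin 3)),
      (∀ t, moebiusAct G (f t) = chi (F' t)) → (∀ t, curvature F' t ≠ 0) →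
        totalTwist F' L = totalTwist F L) := by
  have hFs : ContDiff ℝ ∞ F := contDiff_of_frames hF fun q => by
    obtain ⟨U, hU, hq, e, he, -⟩ := hgen q
    exact ⟨U, hU, hq, e, he.toIsFrame⟩
  have h := frenetSerret hFs hk
  have hE := h.frenetFrame_isFrenetFrame hF fun t => h.regular_of_generic hF (hgen t)
  refine ⟨⟨_, hE, fun e he => h.eq_frenetFrame hF he⟩,
    fun e he => frenet_totalTwist hf.periodic hF hk he, fun G F' hF' hk' => ?_⟩
  obtain ⟨hmc, hGe⟩ := moebiusAct_frenet hE G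
  -- The translated frame `G e` is a Frenet frame of χ ∘ F', and it also supplies the smoothness of
  -- `F'`. Both twists thus equal the integral of the same form.
  have h1 := frenet_totalTwist (fun t => by rw [hf.periodic t]) hF' hk' hGe
  rw [← h1, ← frenet_totalTwist hf.periodic hF hk hE]
  simp only [mu2, conformalSpeed, hmc]
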